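/- Let $\Gamma$ be a finite simplicial graph with vertex set $V$, $|V|\ge 2$. For $A\subseteq V$ let $\mathrm{link}_\Gamma(A)$ be the set of vertices adjacent to every element of $A$. Assume that $\Gamma$ is irreducible, i.e. $V$ is not the union of two disjoint non-empty subsets $A,B$ with $B=\mathrm{link}_\Gamma(A)$. Let $\{G_v\}_{v\in V}$ be an arbitrary family of groups and let $G$ be their graph product with respect to $\Gamma$, i.e. the quotient of the free product of the groups $G_v$ by the relations $[a,b]=1$ for all $a\in G_u$, $b\in G_v$ with $u,v$ adjacent in $\Gamma$. For $S\subseteq V$ let $G_S\leqslant G$ be the subgroup generated by the $G_v$ with $v\in S$ (so $G_\emptyset=\{1\}$). A proper parabolic subgroup of $G$ is a subgroup of the form $fG_Sf^{-1}$ with $f\in G$ and $S\subsetneqq V$. Then for every subgroup $H\leqslant G$ at least one of the following is true: 1. $H$ is contained in a proper parabolic subgroup of $G$; 2. $H\cong\mathbb{Z}$; 3. $H\cong\mathbb{D}_\infty$, the infinite dihedral group; 4. for every proper subset $S\subsetneqq V$ there is a subgroup $F=F(S)\leqslant H$ such that $F\cong\mathbb{F}_2$, the free group of rank $2$, and $F\cap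 gG_Sg^{-1}=\{1\}$ for all $g\in G$. -/

import Mathlib

namespace GraphProd

universe u w

section Graph

variable {V : Type u}

/-- The link of a set `A` of vertices: the vertices adjacent to every element of `A`. -/
def link (Γ : SimpleGraph V) (A : Set V) : Set V :=
  ⋂ v ∈ A, Γ.neighborSet v

/-- `Γ` is irreducible: its vertex set is not a union of two disjoint non-empty subsets `A`, `B`
with `B = link A`. -/
def IsIrreducible (Γ : SimpleGraph V) : Prop :=
  ¬ ∃ A B : Set V, A.Nonempty ∧ B.Nonempty ∧ Disjoint A B ∧ A ∪ B = Set.univ ∧ B = link Γ A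

end Graph

section Product

variable {V : Type u} (Γ : SimpleGraph V) (G : V → Type w) [∀ v, Group (G v)]

/-- The defining relators of the graph product, in the free product of the vertex groups:
the commutators of elements of adjacent vertex groups. -/
def relators : Set (Monoid.CoprodI G) :=
  {r | ∃ (u v : V) (_ : Γ.Adj u v) (a : G u) (b : G v),
    r = Monoid.CoprodI.of a * Monoid.CoprodI.of b *
      (Monoid.CoprodI.of a)⁻¹ * (Monoid.CoprodI.of b)⁻¹}

/-- The graph product of the groups `G v` with respect to `Γ`: the quotient of their free product
by the normal closure of the defining relators. -/
abbrev GraphProduct : Type (max u w) :=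
  Monoid.CoprodI G ⧸ Subgroup.normalClosure (relators Γ G)

/-- The canonical homomorphism from a vertex group to the graph product. -/
def of (v : V) : G v →* GraphProduct Γ G :=
  (QuotientGroup.mk' (Subgroup.normalClosure (relators Γ G))).comp Monoid.CoprodI.of

/-- The full subgroup `G_S`: the subgroup generated by the vertex groups `G v` with `v ∈ S`. -/
def fullSubgroup (S : Set V) : Subgroup (GraphProduct Γ G) :=
  Subgroup.closure (⋃ v ∈ S, Set.range (of Γ G v))

/-- The conjugate `g G_S g⁻¹` of a full subgroup. -/
def conjFullSubgroup (g : GraphProduct Γ G) (S : Set V) : Subgroup (GraphProduct Γ G) :=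
  (fullSubgroup Γ G S).map (MulAut.conj g).toMonoidHom

/-- `K` is a proper parabolic subgroup: `K = f G_S f⁻¹` for some element `f` and some proper subset
`S` of the vertex set. -/
def IsProperParabolic (K : Subgroup (GraphProduct Γ G)) : Prop :=
  ∃ (S : Set V) (f : GraphProduct Γ G), S ≠ Set.univ ∧ K = conjFullSubgroup Γ G f S

end Product

end GraphProd

/-!
Fix a vertex `v`. The graph product is the amalgam of `G_{V ∖ v}` and `G_{star v}` over
`G_{link v}`, so it acts on the Bass–Serre tree of this splitting. Point stabilisers are conjugates
of `G_{V ∖ v}` and `G_{star v}`, hence proper parabolic subgroups, since irreducibility makes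
`star v` a proper subset. If `v ∉ S`, then every conjugate of `G_S` fixes a point. A free group of
rank two acting freely on the tree therefore meets every conjugate of `G_S` trivially, and the task
is to find one in `H`, taking for `v` any vertex outside the given proper subset `S`.

A group acting on a tree without inversions falls into one of three cases
(`IsTreeAction.trichotomy`).
* Every element fixes a point. Then `H` lies in a proper parabolic subgroup
  (`exists_proper_parabolic_of_fixesPoint`). As `H` need not be finitely generated, Serre's lemma is
  applied to a subgroup of `H` with a fixed point whose parabolic closure is as large as possible.
* Ping-pong with two hyperbolic elements gives a free subgroup of rank two acting freely.
* There is a normal subgroup `N` all of whose elements fix points, and `H` is infinite cyclic or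
  infinite dihedral if `N` is trivial. If `N` is nontrivial, then by the first case its parabolic
  closure `f G_T f⁻¹` is proper, and `H` normalises it. The normaliser lies in
  `f G_{T ∪ link T} f⁻¹` (`mem_conj_union_link_of_normalizes`), which is proper because the graph is
  irreducible.

The normal form theorem for graph products is replaced by the wall functions: `wall v g` is the
initial syllable of `g` of type `v`, constructed by letting the graph product act on pairs of its
elements. They show that the graph of cosets is a tree (each edge is a bridge, whose two sides are
told apart by `wall v`), and they control products with no cancellation, which gives intersections
of parabolic subgroups, parabolic closures and normalisers.

Trees enter the dynamical part only through their distance, an integral metric satisfying the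
four-point condition (`IsTreeMetric`); ends are sequences of points modulo bounded distance.
-/

namespace GraphProd

universe u w

section Wall

variable {V : Type u} {Γ : SimpleGraph V} {G : V → Type w} [∀ v, Group (G v)]

/-! ### Full subgroups -/

theorem of_mem_fullSubgroup {S : Set V} {v : V} (hv : v ∈ S) (a : G v) :
    of Γ G v a ∈ fullSubgroup Γ G S :=
  Subgroup.subset_closure (Set.mem_biUnion hv ⟨a, rfl⟩)

theorem fullSubgroup_mono {S T : Set V} (h : S ⊆ T) :
    fullSubgroup Γ G S ≤ fullSubgroup Γ G T :=
  Subgroup.closure_mono (Set.biUnion_subset_biUnion_left h)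

theorem of_mul_of_comm {s t : V} (h : Γ.Adj s t) (a : G s) (b : G t) :
    of Γ G s a * of Γ G t b = of Γ G t b * of Γ G s a := by
  have h1 : ((Monoid.CoprodI.of a * Monoid.CoprodI.of b *
      (Monoid.CoprodI.of a)⁻¹ * (Monoid.CoprodI.of b)⁻¹ : Monoid.CoprodI G) :
      GraphProduct Γ G) = 1 :=
    (QuotientGroup.eq_one_iff _).2 (Subgroup.subset_normalClosure ⟨s, t, h, a, b, rfl⟩)
  have h2 : of Γ G s a * of Γ G t b * (of Γ G s a)⁻¹ * (of Γ G t b)⁻¹ = 1 := h1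
  rw [mul_inv_eq_one, mul_inv_eq_iff_eq_mul] at h2
  exact h2

@[elab_as_elim]
theorem fullSubgroup_induction_right {S : Set V}
    {p : (g : GraphProduct Γ G) → g ∈ fullSubgroup Γ G S → Prop} (one : p 1 (one_mem _))
    (mul : ∀ g, ∀ hg : g ∈ fullSubgroup Γ G S, ∀ t, ∀ ht : t ∈ S, ∀ c : G t, p g hg →
      p (g * of Γ G t c) (mul_mem hg (of_mem_fullSubgroup ht c)))
    {g : GraphProduct Γ G} (hg : g ∈ fullSubgroup Γ G S) : p g hg := by
  induction hg using Subgroup.closure_induction_right with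
  | one => exact one
  | mul_right x hx y hy ih =>
    obtain ⟨t, ht, c, rfl⟩ := Set.mem_iUnion₂.1 hy
    exact mul x hx t ht c ih
  | mul_inv_cancel x hx y hy ih =>
    obtain ⟨t, ht, c, rfl⟩ := Set.mem_iUnion₂.1 hy
    have := mul x hx t ht c⁻¹ ih
    simpa only [map_inv] using this

theorem fullSubgroup_univ : fullSubgroup Γ G Set.univ = ⊤ := by
  have h : (fullSubgroup Γ G Set.univ).comap
      (QuotientGroup.mk' (Subgroup.normalClosure (relators Γ G))) = ⊤ := by
    rw [eq_top_iff]
    intro x _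
    induction x using Monoid.CoprodI.induction_on with
    | one => exact one_mem _
    | of i m => exact of_mem_fullSubgroup (Set.mem_univ i) m
    | mul x y hx hy => exact mul_mem (hx trivial) (hy trivial)
  rw [eq_top_iff]
  intro x _
  obtain ⟨y, rfl⟩ := QuotientGroup.mk'_surjective _ x
  have : y ∈ (fullSubgroup Γ G Set.univ).comap
      (QuotientGroup.mk' (Subgroup.normalClosure (relators Γ G))) := h ▸ Subgroup.mem_top y
  exact this

theorem induction_right {p : GraphProduct Γ G → Prop} (one : p 1)
    (mul : ∀ g t, ∀ c : G t, p g → p (g * of Γ G t c)) (g : GraphProduct Γ G) : p g :=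
  fullSubgroup_induction_right (S := Set.univ) (p := fun g _ => p g) one
    (fun g _ t _ c h => mul g t c h) (fullSubgroup_univ (Γ := Γ) (G := G) ▸ Subgroup.mem_top g)

/-- The star of `v`: the vertex `v` together with its neighbours. -/
def star (Γ : SimpleGraph V) (v : V) : Set V := insert v (Γ.neighborSet v)

theorem commute_of_mem_link {v : V} {l : GraphProduct Γ G}
    (hl : l ∈ fullSubgroup Γ G (Γ.neighborSet v)) (a : G v) :
    l * of Γ G v a = of Γ G v a * l := by
  induction hl using fullSubgroup_induction_right with
  | one => simp
  | mul g hg t ht c ih => rw [mul_assoc, ← of_mul_of_comm ht a c, ← mul_assoc, ih, mul_assoc]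

theorem mem_star_of {v : V} (a : G v) : of Γ G v a ∈ fullSubgroup Γ G (star Γ v) :=
  of_mem_fullSubgroup (Set.mem_insert _ _) a

theorem link_le_star (v : V) :
    fullSubgroup Γ G (Γ.neighborSet v) ≤ fullSubgroup Γ G (star Γ v) :=
  fullSubgroup_mono (Set.subset_insert _ _)

theorem exists_of_mem_star {v : V} {g : GraphProduct Γ G}
    (hg : g ∈ fullSubgroup Γ G (star Γ v)) :
    ∃ l ∈ fullSubgroup Γ G (Γ.neighborSet v), ∃ a : G v, g = l * of Γ G v a := by
  induction hg using fullSubgroup_induction_right with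
  | one => exact ⟨1, one_mem _, 1, by simp⟩
  | mul g hg t ht c ih =>
    obtain ⟨l, hl, a, rfl⟩ := ih
    rcases ht with rfl | ht
    · exact ⟨l, hl, a * c, by rw [map_mul, mul_assoc]⟩
    · exact ⟨l * of Γ G t c, mul_mem hl (of_mem_fullSubgroup ht c), a, by
        rw [mul_assoc, of_mul_of_comm ht, mul_assoc]⟩

/-! ### The wall function of a vertex -/

open scoped Classical in
/-- The increment of the wall function of `v` along the edge of the Cayley graph from `g` to
`g * of c`: it is `of c` if the edge is of type `v` and starts in `G_{star v}`, and `1`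
otherwise. -/
noncomputable def wallStep (v t : V) (c : G t) (g : GraphProduct Γ G) : GraphProduct Γ G :=
  if t = v ∧ g ∈ fullSubgroup Γ G (star Γ v) then of Γ G t c else 1

theorem wallStep_mul_left (v t : V) (c : G t) {s g : GraphProduct Γ G}
    (hs : s ∈ fullSubgroup Γ G (star Γ v)) : wallStep v t c (s * g) = wallStep v t c g := by
  have h := Subgroup.mul_mem_cancel_left (fullSubgroup Γ G (star Γ v)) (y := g) hs
  classical
  exact if_congr (and_congr_right fun _ => h) rfl rfl

theorem end_mul_apply {X : Type*} (f g : Function.End X) (x : X) : (f * g) x = f (g x) := rfl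

/-- Left translations twisted by `wallStep`, as an action of a vertex group on pairs. -/
noncomputable def wallHomVertex (v t : V) :
    G t →* Function.End (GraphProduct Γ G × GraphProduct Γ G) where
  toFun c := fun p => (of Γ G t c * p.1, wallStep v t c p.1 * p.2)
  map_one' := by
    funext p
    simp only [map_one, one_mul, wallStep, ite_self]
    rfl
  map_mul' c e := by
    funext p
    have key : wallStep v t (c * e) p.1 = wallStep v t c (of Γ G t e * p.1) *
        wallStep v t e p.1 := by
      by_cases ht : t = v
      · subst ht
        rw [wallStep_mul_left _ _ _ (mem_star_of e)]
        by_cases hp : p.1 ∈ fullSubgroup Γ G (star Γ t) <;> simp [wallStep, hp]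
      · simp [wallStep, ht]
    change _ = (of Γ G t c * (of Γ G t e * p.1), wallStep v t c (of Γ G t e * p.1) *
      (wallStep v t e p.1 * p.2))
    rw [key, map_mul, mul_assoc, mul_assoc]

theorem wallHomVertex_apply (v t : V) (c : G t) (p : GraphProduct Γ G × GraphProduct Γ G) :
    wallHomVertex v t c p = (of Γ G t c * p.1, wallStep v t c p.1 * p.2) := rfl

theorem wallHomVertex_comm (v : V) {s t : V} (h : Γ.Adj s t) (a : G s) (b : G t) :
    wallHomVertex (Γ := Γ) v s a * wallHomVertex v t b =
      wallHomVertex v t b * wallHomVertex v s a := by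
  funext p
  have h1 : ∀ {s t : V} (_ : Γ.Adj s t) (a : G s) (b : G t),
      wallStep v s a (of Γ G t b * p.1) = wallStep v s a p.1 := by
    intro s t h a b
    by_cases hs : s = v
    · subst hs
      exact wallStep_mul_left _ _ _ (of_mem_fullSubgroup (Set.mem_insert_of_mem _ h) b)
    · simp [wallStep, hs]
  have h2 : wallStep v s a p.1 * wallStep v t b p.1 = wallStep v t b p.1 * wallStep v s a p.1 := by
    by_cases hs : s = v
    · have ht : t ≠ v := by rintro rfl; exact h.ne hs
      simp [wallStep, ht]
    · simp [wallStep, hs]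
  simp only [end_mul_apply, wallHomVertex_apply]
  rw [h1 h, h1 h.symm, ← mul_assoc, ← mul_assoc, of_mul_of_comm h, ← mul_assoc, ← mul_assoc, h2]

/-- The twisted action of the whole graph product: the twisted actions of adjacent vertex groups
commute. -/
noncomputable def wallHom (v : V) :
    GraphProduct Γ G →* Function.End (GraphProduct Γ G × GraphProduct Γ G) :=
  QuotientGroup.lift _ (Monoid.CoprodI.lift (wallHomVertex v)) (by
    rw [← Subgroup.normalClosure_subset_iff]
    rintro _ ⟨s, t, h, a, b, rfl⟩
    rw [SetLike.mem_coe, MonoidHom.mem_ker]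
    rw [← map_inv, ← map_inv]
    simp only [map_mul, Monoid.CoprodI.lift_of]
    rw [wallHomVertex_comm v h, mul_assoc (wallHomVertex v t b), ← map_mul, mul_inv_cancel,
      map_one, mul_one, ← map_mul, mul_inv_cancel, map_one])

theorem wallHom_of (v t : V) (c : G t) (p : GraphProduct Γ G × GraphProduct Γ G) :
    wallHom v (of Γ G t c) p = (of Γ G t c * p.1, wallStep v t c p.1 * p.2) := by
  have : wallHom (Γ := Γ) v (of Γ G t c) = wallHomVertex v t c :=
    Monoid.CoprodI.lift_of (wallHomVertex v) c
  rw [this]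
  rfl

theorem wallHom_fst (v : V) (g : GraphProduct Γ G) :
    ∀ p, (wallHom v g p).1 = g * p.1 := by
  induction g using induction_right with
  | one => intro p; rw [map_one, one_mul]; rfl
  | mul g t c ih =>
    intro p
    rw [map_mul, end_mul_apply, ih, wallHom_of, mul_assoc]

/-- The wall function of `v`: the element of `G_v` naming the sector of the wall `G_{star v}`
that contains `g`. In terms of normal forms it is the initial syllable of `g` of type `v`, or `1`
if there is none. -/
noncomputable def wall (v : V) (g : GraphProduct Γ G) : GraphProduct Γ G :=
  ((wallHom v g⁻¹ (1, 1)).2)⁻¹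

@[simp]
theorem wall_one (v : V) : wall v (1 : GraphProduct Γ G) = 1 := by
  rw [wall, inv_one, map_one]
  exact inv_one

theorem wall_mul_of (v t : V) (c : G t) (g : GraphProduct Γ G) :
    wall v (g * of Γ G t c) = wall v g * wallStep v t c g := by
  have : (wallStep v t c⁻¹ g⁻¹ : GraphProduct Γ G)⁻¹ = wallStep v t c g := by
    by_cases h : t = v ∧ g ∈ fullSubgroup Γ G (star Γ v) <;> simp [wallStep, h]
  rw [wall, mul_inv_rev, ← map_inv, map_mul, end_mul_apply, wallHom_of,
    wallHom_fst, mul_one, mul_inv_rev, this, wall]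

theorem wall_mul_of_ne {v t : V} (h : t ≠ v) (c : G t) (g : GraphProduct Γ G) :
    wall v (g * of Γ G t c) = wall v g := by
  simp [wall_mul_of, wallStep, h]

theorem wall_mul_of_notMem {v : V} (t : V) (c : G t) {g : GraphProduct Γ G}
    (hg : g ∉ fullSubgroup Γ G (star Γ v)) : wall v (g * of Γ G t c) = wall v g := by
  simp [wall_mul_of, wallStep, hg]

theorem wall_mul_of_mem {v : V} (c : G v) {g : GraphProduct Γ G}
    (hg : g ∈ fullSubgroup Γ G (star Γ v)) :
    wall v (g * of Γ G v c) = wall v g * of Γ G v c := by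
  simp [wall_mul_of, wallStep, hg]

theorem wall_mul_right {v : V} {S : Set V} (hv : v ∉ S) (g : GraphProduct Γ G)
    {x : GraphProduct Γ G} (hx : x ∈ fullSubgroup Γ G S) : wall v (g * x) = wall v g := by
  induction hx using fullSubgroup_induction_right with
  | one => rw [mul_one]
  | mul x _ t ht c ih => rw [← mul_assoc, wall_mul_of_ne (by rintro rfl; exact hv ht), ih]

theorem wall_of_mem {v : V} {S : Set V} (hv : v ∉ S)
    {x : GraphProduct Γ G} (hx : x ∈ fullSubgroup Γ G S) : wall v x = 1 := by
  rw [← one_mul x, wall_mul_right hv 1 hx, wall_one]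

theorem wall_of_mul (v : V) (a : G v) (g : GraphProduct Γ G) :
    wall v (of Γ G v a * g) = of Γ G v a * wall v g := by
  induction g using induction_right with
  | one =>
    have := wall_mul_of_mem (Γ := Γ) a (one_mem (fullSubgroup Γ G (star Γ v)))
    simpa using this
  | mul g t c ih =>
    rw [← mul_assoc, wall_mul_of, ih, wallStep_mul_left _ _ _ (mem_star_of a), mul_assoc,
      wall_mul_of]

theorem wall_link_mul {v : V} {l : GraphProduct Γ G}
    (hl : l ∈ fullSubgroup Γ G (Γ.neighborSet v)) (g : GraphProduct Γ G) :
    wall v (l * g) = wall v g := by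
  induction g using induction_right with
  | one => rw [mul_one, wall_one]; exact wall_of_mem (by simp) hl
  | mul g t c ih =>
    rw [← mul_assoc, wall_mul_of, ih, wallStep_mul_left _ _ _ (link_le_star v hl), wall_mul_of]

theorem mem_link_of_mem_star {v : V} {g : GraphProduct Γ G}
    (hg : g ∈ fullSubgroup Γ G (star Γ v)) (h : wall v g = 1) :
    g ∈ fullSubgroup Γ G (Γ.neighborSet v) := by
  obtain ⟨l, hl, a, rfl⟩ := exists_of_mem_star hg
  have h1 := wall_of_mul (Γ := Γ) v a 1
  rw [wall_link_mul hl, ← mul_one (of Γ G v a), h1, wall_one, mul_one] at h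
  rwa [h, mul_one]

/-- Distinct non-adjacent vertices cannot both be types of initial syllables: two walls through
the identity either cross or are nested. -/
theorem adj_of_wall_ne_one {s t : V} (hst : s ≠ t) {g : GraphProduct Γ G}
    (hs : wall s g ≠ 1) (ht : wall t g ≠ 1) : Γ.Adj s t := by
  by_contra hadj
  -- When a walk from `1` first crosses the wall of `x`, it is at a point of `G_{link x}`, which
  -- lies on the trivial side of the wall of `y`.
  have step : ∀ {x y : V}, x ≠ y → ¬ Γ.Adj x y → ∀ (g : GraphProduct Γ G) (c : G x),
      wall x g = 1 → wall x (g * of Γ G x c) = 1 ∨ wall y (g * of Γ G x c) = 1 := by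
    intro x y hxy hn g c h
    by_cases hg : g ∈ fullSubgroup Γ G (star Γ x)
    · right
      rw [wall_mul_of_ne hxy]
      exact wall_of_mem hn (mem_link_of_mem_star hg h)
    · left
      rw [wall_mul_of_notMem x c hg, h]
  have : wall s g = 1 ∨ wall t g = 1 := by
    clear hs ht
    induction g using induction_right with
    | one => simp
    | mul g r c ih =>
      by_cases hrs : r = s
      · subst hrs
        rcases ih with h | h
        · exact step hst hadj g c h
        · right
          rw [wall_mul_of_ne hst, h]
      · by_cases hrt : r = t
        · subst hrt
          rcases ih with h | h
          · left
            rw [wall_mul_of_ne hrs, h]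
          · exact (step hst.symm (fun h => hadj h.symm) g c h).symm
        · rwa [wall_mul_of_ne hrs, wall_mul_of_ne hrt]
  tauto

end Wall

section Parabolic

variable {V : Type u} {Γ : SimpleGraph V} {G : V → Type w} [∀ v, Group (G v)]

/-! ### Syllable length -/

/-- The product in the graph product of a list of syllables. -/
def syllableProd (Γ : SimpleGraph V) (l : List (Σ v, G v)) : GraphProduct Γ G :=
  (l.map fun s => of Γ G s.1 s.2).prod

@[simp]
theorem syllableProd_cons (s : Σ v, G v) (l : List (Σ v, G v)) :
    syllableProd Γ (s :: l) = of Γ G s.1 s.2 * syllableProd Γ l := by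
  simp [syllableProd]

theorem syllableProd_concat (l : List (Σ v, G v)) (s : Σ v, G v) :
    syllableProd Γ (l ++ [s]) = syllableProd Γ l * of Γ G s.1 s.2 := by
  simp [syllableProd]

theorem exists_syllableProd_eq (g : GraphProduct Γ G) :
    ∃ n, ∃ l : List (Σ v, G v), l.length = n ∧ syllableProd Γ l = g := by
  induction g using induction_right with
  | one => exact ⟨0, [], rfl, rfl⟩
  | mul g t c ih =>
    obtain ⟨n, l, -, rfl⟩ := ih
    exact ⟨_, l ++ [⟨t, c⟩], rfl, syllableProd_concat l ⟨t, c⟩⟩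

open scoped Classical in
/-- The syllable length: the least number of elements of vertex groups with product `g`. -/
noncomputable def len (g : GraphProduct Γ G) : ℕ := Nat.find (exists_syllableProd_eq g)

theorem exists_syllableProd_len (g : GraphProduct Γ G) :
    ∃ l : List (Σ v, G v), l.length = len g ∧ syllableProd Γ l = g := by
  classical
  exact Nat.find_spec (exists_syllableProd_eq g)

theorem len_syllableProd_le (l : List (Σ v, G v)) : len (syllableProd Γ l) ≤ l.length := by
  classical
  exact Nat.find_min' _ ⟨l, rfl, rfl⟩

theorem len_of_mul_le {v : V} (a : G v) (g : GraphProduct Γ G) :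
    len (of Γ G v a * g) ≤ len g + 1 := by
  obtain ⟨l, hl, rfl⟩ := exists_syllableProd_len g
  rw [← hl]
  exact len_syllableProd_le (⟨v, a⟩ :: l) |>.trans' (by rw [syllableProd_cons])

theorem len_mul_of_le {v : V} (a : G v) (g : GraphProduct Γ G) :
    len (g * of Γ G v a) ≤ len g + 1 := by
  obtain ⟨l, hl, rfl⟩ := exists_syllableProd_len g
  rw [← hl]
  refine (len_syllableProd_le (l ++ [⟨v, a⟩])).trans' (by rw [syllableProd_concat]) |>.trans ?_
  simp

theorem len_inv (g : GraphProduct Γ G) : len g⁻¹ = len g := by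
  have h : ∀ g : GraphProduct Γ G, len g⁻¹ ≤ len g := by
    intro g
    obtain ⟨l, hl, hg⟩ := exists_syllableProd_len g
    rw [← hl, ← hg]
    clear hl hg
    induction l with
    | nil => simpa [syllableProd] using len_syllableProd_le (Γ := Γ) (G := G) []
    | cons s l ih =>
      rw [syllableProd_cons, mul_inv_rev, ← map_inv]
      exact (len_mul_of_le _ _).trans (by simpa using ih)
  exact le_antisymm (h g) (by simpa using h g⁻¹)

/-- An element with an initial syllable of type `v` is shortened by some element of `G_v`: the
syllable of a shortest word that first crosses the wall of `v` can be moved to the front. -/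
theorem exists_len_of_mul_lt {v : V} {g : GraphProduct Γ G} (h : wall v g ≠ 1) :
    ∃ c : G v, len (of Γ G v c * g) < len g := by
  obtain ⟨l, hl, rfl⟩ := exists_syllableProd_len g
  rw [← hl]
  clear hl
  induction l using List.reverseRecOn with
  | nil => exact absurd (wall_one v) h
  | append_singleton l s ih =>
    rw [syllableProd_concat] at h ⊢
    by_cases hl : wall v (syllableProd Γ l) = 1
    · obtain ⟨t, b⟩ := s
      by_cases ht : t = v
      · subst ht
        by_cases hs : syllableProd Γ l ∈ fullSubgroup Γ G (star Γ t)
        · refine ⟨b⁻¹, ?_⟩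
          rw [commute_of_mem_link (mem_link_of_mem_star hs hl), map_inv, inv_mul_cancel_left]
          simpa using Nat.lt_succ_of_le (len_syllableProd_le l)
        · rw [wall_mul_of_notMem t b hs] at h
          exact absurd hl h
      · rw [wall_mul_of_ne ht] at h
        exact absurd hl h
    · obtain ⟨c, hc⟩ := ih hl
      refine ⟨c, ?_⟩
      rw [← mul_assoc, List.length_append, List.length_singleton]
      exact (len_mul_of_le _ _).trans_lt (by omega)

/-- A nontrivial element splits off an initial syllable. -/
theorem exists_eq_of_mul {x : GraphProduct Γ G} (hx : x ≠ 1) :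
    ∃ v, ∃ a : G v, ∃ y, x = of Γ G v a * y ∧ len y < len x ∧ wall v x = of Γ G v a ∧
      of Γ G v a ≠ 1 := by
  obtain ⟨l, hl, hlx⟩ := exists_syllableProd_len x
  cases l with
  | nil => exact absurd hlx.symm hx
  | cons s l =>
    obtain ⟨v, a⟩ := s
    rw [syllableProd_cons] at hlx
    have hy := len_syllableProd_le (Γ := Γ) l
    rw [List.length_cons] at hl
    have hw : wall v (syllableProd Γ l) = 1 := by
      by_contra hne
      obtain ⟨e, he⟩ := exists_len_of_mul_lt hne
      have h1 := len_of_mul_le (a * e⁻¹) (of Γ G v e * syllableProd Γ l)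
      have h2 : of Γ G v (a * e⁻¹) * (of Γ G v e * syllableProd Γ l) = x := by
        rw [← hlx, ← mul_assoc, ← map_mul, inv_mul_cancel_right]
      rw [h2] at h1
      omega
    refine ⟨v, a, syllableProd Γ l, hlx.symm, by omega, ?_, ?_⟩
    · rw [← hlx, wall_of_mul, hw, mul_one]
    · intro h1
      rw [h1, one_mul] at hlx
      rw [hlx] at hy
      omega

theorem mem_of_wall_ne_one {v : V} {S : Set V} {x : GraphProduct Γ G}
    (hx : x ∈ fullSubgroup Γ G S) (h : wall v x ≠ 1) : v ∈ S := by
  by_contra hv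
  exact h (wall_of_mem hv hx)

/-- Induction on the elements of a full subgroup by splitting off initial syllables. -/
@[elab_as_elim]
theorem reduced_induction {S : Set V}
    {p : (x : GraphProduct Γ G) → x ∈ fullSubgroup Γ G S → Prop} (one : p 1 (one_mem _))
    (mul : ∀ v, ∀ hv : v ∈ S, ∀ a : G v, ∀ y, ∀ hy : y ∈ fullSubgroup Γ G S, of Γ G v a ≠ 1 →
      wall v (of Γ G v a * y) = of Γ G v a → p y hy →
      p (of Γ G v a * y) (mul_mem (of_mem_fullSubgroup hv a) hy))
    {x : GraphProduct Γ G} (hx : x ∈ fullSubgroup Γ G S) : p x hx := by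
  induction hn : len x using Nat.strong_induction_on generalizing x with
  | _ n ih =>
    by_cases h1 : x = 1
    · subst h1
      exact one
    · obtain ⟨v, a, y, rfl, hlt, hw, ha⟩ := exists_eq_of_mul h1
      have hv : v ∈ S := mem_of_wall_ne_one hx (by rwa [hw])
      have hy := (Subgroup.mul_mem_cancel_left _ (of_mem_fullSubgroup hv a)).1 hx
      exact mul v hv a y hy ha hw (ih _ (hn ▸ hlt) hy rfl)

/-! ### Reduced products and intersections of parabolic subgroups -/

/-- If `d` has no initial syllable in `S`, then the initial syllables of `x * d` in `S` are those
of `x`, for every `x` in `G_S`. -/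
theorem wall_mul_of_reduced {S : Set V} {x d : GraphProduct Γ G}
    (hx : x ∈ fullSubgroup Γ G S) (hd : ∀ v ∈ S, wall v d = 1) :
    ∀ v ∈ S, wall v (x * d) = wall v x := by
  induction hx using reduced_induction with
  | one => intro v hv; rw [one_mul, hd v hv, wall_one]
  | mul s hs a y hy ha hw ih =>
    intro v hv
    rw [mul_assoc]
    by_cases hsv : s = v
    · subst hsv
      rw [wall_of_mul, wall_of_mul, ih s hs]
    · by_cases hadj : Γ.Adj v s
      · have hl : of Γ G s a ∈ fullSubgroup Γ G (Γ.neighborSet v) := of_mem_fullSubgroup hadj a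
        rw [wall_link_mul hl, wall_link_mul hl, ih v hv]
      · -- Both elements have the initial syllable `a`, which excludes one of type `v`.
        have h1 : wall s (of Γ G s a * (y * d)) ≠ 1 := by
          rw [wall_of_mul, ih s hs, ← wall_of_mul, hw]
          exact ha
        have h2 : wall s (of Γ G s a * y) ≠ 1 := by rwa [hw]
        have h3 : ∀ {g : GraphProduct Γ G}, wall s g ≠ 1 → wall v g = 1 := by
          intro g hg
          by_contra h
          exact hadj (adj_of_wall_ne_one (Ne.symm hsv) h hg)
        rw [h3 h1, h3 h2]

/-- In a product `y * e` without cancellation, if the product lies in a full subgroup then so does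
the factor `e`. -/
theorem mem_of_reduced_mul_mem {T R : Set V} {y e : GraphProduct Γ G}
    (hy : y ∈ fullSubgroup Γ G T) (he : ∀ v ∈ T, wall v e = 1)
    (h : y * e ∈ fullSubgroup Γ G R) : e ∈ fullSubgroup Γ G R := by
  induction hy using reduced_induction with
  | one => rwa [one_mul] at h
  | mul v hv a y hy ha hw ih =>
    have h1 := wall_mul_of_reduced (mul_mem (of_mem_fullSubgroup hv a) hy) he v hv
    have hvR : v ∈ R := mem_of_wall_ne_one h (by rw [h1, hw]; exact ha)
    rw [mul_assoc] at h
    exact ih ((Subgroup.mul_mem_cancel_left _ (of_mem_fullSubgroup hvR a)).1 h)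

theorem mem_fullSubgroup_iInter {S : Set V} {A : V → Set V} {d : GraphProduct Γ G}
    (h : ∀ v ∈ S, d ∈ fullSubgroup Γ G (A v)) : d ∈ fullSubgroup Γ G (⋂ v ∈ S, A v) := by
  have hd : d ∈ fullSubgroup Γ G Set.univ := fullSubgroup_univ (Γ := Γ) (G := G) ▸ trivial
  induction hd using reduced_induction with
  | one => exact one_mem _
  | mul v hv a y hy ha hw ih =>
    have hvA : ∀ s ∈ S, v ∈ A s := fun s hs => mem_of_wall_ne_one (h s hs) (by rwa [hw])
    exact mul_mem (of_mem_fullSubgroup (Set.mem_iInter₂.2 hvA) a) (ih fun s hs =>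
      (Subgroup.mul_mem_cancel_left _ (of_mem_fullSubgroup (hvA s hs) a)).1 (h s hs))

/-- A walk from `d` labelled by a word in `T` that crosses the wall of `v` meets that wall. -/
theorem exists_mem_star_of_wall_ne {v : V} {T : Set V} {d y : GraphProduct Γ G}
    (hy : y ∈ fullSubgroup Γ G T) (h : wall v (d * y) ≠ wall v d) :
    v ∈ T ∧ ∃ z ∈ fullSubgroup Γ G T, d * z ∈ fullSubgroup Γ G (star Γ v) ∧
      wall v (d * z) = wall v d := by
  induction hy using fullSubgroup_induction_right with
  | one => simp at h
  | mul y hy t ht c ih =>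
    by_cases hy' : wall v (d * y) = wall v d
    · rw [← mul_assoc] at h
      have htv : t = v := by
        by_contra hne
        rw [wall_mul_of_ne hne] at h
        exact h hy'
      subst htv
      refine ⟨ht, y, hy, ?_, hy'⟩
      by_contra hs
      rw [wall_mul_of_notMem t c hs] at h
      exact h hy'
    · exact ih hy'

theorem commute_of_forall_mem_link {U : Set V} {d x : GraphProduct Γ G}
    (hd : ∀ v ∈ U, d ∈ fullSubgroup Γ G (Γ.neighborSet v)) (hx : x ∈ fullSubgroup Γ G U) :
    d * x = x * d := by
  induction hx using fullSubgroup_induction_right with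
  | one => simp
  | mul g hg t ht c ih => rw [← mul_assoc, ih, mul_assoc, commute_of_mem_link (hd t ht), mul_assoc]

/-- If `d` has no initial syllable in `S` and no final syllable in `T`, then
`G_S ∩ d G_T d⁻¹` is generated by the vertices of `S ∩ T` whose link carries `d`. -/
theorem mem_of_mul_eq_mul {S T : Set V} {d x : GraphProduct Γ G}
    (hS : ∀ v ∈ S, wall v d = 1) (hT : ∀ v ∈ T, wall v d⁻¹ = 1)
    (hx : x ∈ fullSubgroup Γ G S) : ∀ y ∈ fullSubgroup Γ G T, x * d = d * y →
    x ∈ fullSubgroup Γ G {v | v ∈ S ∩ T ∧ d ∈ fullSubgroup Γ G (Γ.neighborSet v)} := by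
  induction hx using reduced_induction with
  | one => intro y _ _; exact one_mem _
  | mul v hv a x hx ha hw ih =>
    intro y hy hxy
    have h1 : wall v (d * y) ≠ wall v d := by
      rw [← hxy, wall_mul_of_reduced (mul_mem (of_mem_fullSubgroup hv a) hx) hS v hv, hw, hS v hv]
      exact ha
    obtain ⟨hvT, z, hz, hdz, hwz⟩ := exists_mem_star_of_wall_ne hy h1
    have hl := mem_link_of_mem_star hdz (hwz.trans (hS v hv))
    have hdl : d ∈ fullSubgroup Γ G (Γ.neighborSet v) := by
      rw [← inv_mem_iff]
      refine mem_of_reduced_mul_mem (inv_mem hz) hT ?_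
      rw [← mul_inv_rev]
      exact inv_mem hl
    have hvU : v ∈ {v | v ∈ S ∩ T ∧ d ∈ fullSubgroup Γ G (Γ.neighborSet v)} := ⟨⟨hv, hvT⟩, hdl⟩
    refine mul_mem (of_mem_fullSubgroup hvU a)
      (ih ((of Γ G v a)⁻¹ * y) (mul_mem (inv_mem (of_mem_fullSubgroup hvT a)) hy) ?_)
    rw [← map_inv, ← mul_assoc, commute_of_mem_link hdl, mul_assoc, ← hxy, map_inv, mul_assoc,
      inv_mul_cancel_left]

/-- The intersection of two parabolic subgroups is parabolic, with explicit data: a shortest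
element `d` of the double coset `G_S g G_T` and the set `U` of vertices. -/
theorem exists_fullSubgroup_inter_conj (S T : Set V) (g : GraphProduct Γ G) :
    ∃ s ∈ fullSubgroup Γ G S, ∃ t ∈ fullSubgroup Γ G T, ∃ d : GraphProduct Γ G, ∃ U ⊆ S ∩ T,
      g = s * d * t ∧ (∀ v ∈ U, d ∈ fullSubgroup Γ G (Γ.neighborSet v)) ∧
      ∀ x, x ∈ fullSubgroup Γ G S → g⁻¹ * x * g ∈ fullSubgroup Γ G T →
        s⁻¹ * x * s ∈ fullSubgroup Γ G U := by
  classical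
  have hex : ∃ n, ∃ s ∈ fullSubgroup Γ G S, ∃ t ∈ fullSubgroup Γ G T, ∃ d : GraphProduct Γ G,
      g = s * d * t ∧ len d = n := ⟨_, 1, one_mem _, 1, one_mem _, g, by simp, rfl⟩
  obtain ⟨s, hs, t, ht, d, hg, hd⟩ := Nat.find_spec hex
  have hmin : ∀ s ∈ fullSubgroup Γ G S, ∀ t ∈ fullSubgroup Γ G T, ∀ d' : GraphProduct Γ G,
      g = s * d' * t → len d ≤ len d' := fun s hs t ht d' h =>
    hd.trans_le (Nat.find_min' hex ⟨s, hs, t, ht, d', h, rfl⟩)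
  have hS : ∀ v ∈ S, wall v d = 1 := by
    intro v hv
    by_contra h
    obtain ⟨c, hc⟩ := exists_len_of_mul_lt h
    have := hmin (s * (of Γ G v c)⁻¹) (mul_mem hs (inv_mem (of_mem_fullSubgroup hv c))) t ht
      (of Γ G v c * d) (by rw [hg]; group)
    omega
  have hT : ∀ v ∈ T, wall v d⁻¹ = 1 := by
    intro v hv
    by_contra h
    obtain ⟨c, hc⟩ := exists_len_of_mul_lt h
    have := hmin s hs (of Γ G v c * t) (mul_mem (of_mem_fullSubgroup hv c) ht)
      (of Γ G v c * d⁻¹)⁻¹ (by rw [hg]; group)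
    rw [len_inv] at this
    rw [len_inv] at hc
    omega
  refine ⟨s, hs, t, ht, d, _, fun v hv => hv.1, hg, fun v hv => hv.2, fun x hx hxg =>
    mem_of_mul_eq_mul hS hT (mul_mem (mul_mem (inv_mem hs) hx) hs)
      (t * (g⁻¹ * x * g) * t⁻¹) (mul_mem (mul_mem ht hxg) (inv_mem ht)) ?_⟩
  rw [hg]
  group

theorem mem_conjFullSubgroup {g x : GraphProduct Γ G} {S : Set V} :
    x ∈ conjFullSubgroup Γ G g S ↔ g⁻¹ * x * g ∈ fullSubgroup Γ G S := by
  constructor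
  · rintro ⟨y, hy, rfl⟩
    simpa [mul_assoc] using hy
  · intro h
    exact ⟨_, h, by simp [mul_assoc]⟩

/-- A parabolic subgroup containing `K` whose type has the least number of vertices is contained in
every other parabolic subgroup containing `K`. -/
theorem conjFullSubgroup_le_of_minimal [Finite V] {K : Subgroup (GraphProduct Γ G)}
    {f g : GraphProduct Γ G} {S T : Set V} (hK : K ≤ conjFullSubgroup Γ G f S)
    (hmin : ∀ (g : GraphProduct Γ G) (T : Set V), K ≤ conjFullSubgroup Γ G g T →
      S.ncard ≤ T.ncard) (hT : K ≤ conjFullSubgroup Γ G g T) :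
    conjFullSubgroup Γ G f S ≤ conjFullSubgroup Γ G g T := by
  obtain ⟨s, hs, t, ht, d, U, hU, hg, hd, hx⟩ := exists_fullSubgroup_inter_conj S T (f⁻¹ * g)
  have hUS : U = S := by
    refine Set.eq_of_subset_of_ncard_le (fun v hv => (hU hv).1) (hmin (f * s) U fun x hxK => ?_)
    rw [mem_conjFullSubgroup]
    have h1 := mem_conjFullSubgroup.1 (hK hxK)
    have h2 := mem_conjFullSubgroup.1 (hT hxK)
    have h3 := hx (f⁻¹ * x * f) h1 (by convert h2 using 1; group)
    convert h3 using 1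
    group
  subst hUS
  intro x hxf
  rw [mem_conjFullSubgroup] at hxf ⊢
  have h1 : s⁻¹ * (f⁻¹ * x * f) * s ∈ fullSubgroup Γ G U := mul_mem (mul_mem (inv_mem hs) hxf) hs
  have h2 := commute_of_forall_mem_link hd h1
  have h3 : g⁻¹ * x * g = t⁻¹ * (s⁻¹ * (f⁻¹ * x * f) * s) * t := by
    have hg' : g = f * (s * d * t) := by rw [← hg]; group
    have h4 : s⁻¹ * (f⁻¹ * x * f) * s = d⁻¹ * (s⁻¹ * (f⁻¹ * x * f) * s) * d := by
      rw [mul_assoc d⁻¹, ← h2, inv_mul_cancel_left]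
    rw [h4, hg']
    group
  rw [h3]
  exact mul_mem (mul_mem (inv_mem ht) (fullSubgroup_mono (fun v hv => (hU hv).2) h1)) ht

/-- Every subgroup has a parabolic closure: a parabolic subgroup containing it whose type has the
least number of vertices. -/
theorem exists_parabolicClosure [Finite V] (K : Subgroup (GraphProduct Γ G)) :
    ∃ (f : GraphProduct Γ G) (S : Set V), K ≤ conjFullSubgroup Γ G f S ∧
      ∀ (g : GraphProduct Γ G) (T : Set V), K ≤ conjFullSubgroup Γ G g T → S.ncard ≤ T.ncard := by
  classical
  have hex : ∃ n, ∃ (f : GraphProduct Γ G) (S : Set V), K ≤ conjFullSubgroup Γ G f S ∧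
      S.ncard = n := ⟨_, 1, Set.univ, fun x _ => by
        rw [mem_conjFullSubgroup, fullSubgroup_univ]; trivial, rfl⟩
  obtain ⟨f, S, hK, hS⟩ := Nat.find_spec hex
  exact ⟨f, S, hK, fun g T h => hS.trans_le (Nat.find_min' hex ⟨g, T, h, rfl⟩)⟩

/-- An element normalising `K` normalises its parabolic closure `f G_S f⁻¹`, and therefore lies in
`f G_{S ∪ link S} f⁻¹`. -/
theorem mem_conj_union_link_of_normalizes [Finite V] {K : Subgroup (GraphProduct Γ G)}
    {f h : GraphProduct Γ G} {S : Set V} (hK : K ≤ conjFullSubgroup Γ G f S)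
    (hmin : ∀ (g : GraphProduct Γ G) (T : Set V), K ≤ conjFullSubgroup Γ G g T →
      S.ncard ≤ T.ncard) (hh : ∀ x ∈ K, h⁻¹ * x * h ∈ K) :
    h ∈ conjFullSubgroup Γ G f (S ∪ link Γ S) := by
  obtain ⟨s, hs, t, ht, d, U, hU, hg, hd, hx⟩ := exists_fullSubgroup_inter_conj S S (f⁻¹ * h * f)
  have hUS : U = S := by
    refine Set.eq_of_subset_of_ncard_le (fun v hv => (hU hv).1) (hmin (f * s) U fun x hxK => ?_)
    rw [mem_conjFullSubgroup]
    have h1 := mem_conjFullSubgroup.1 (hK hxK)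
    have h2 := mem_conjFullSubgroup.1 (hK (hh x hxK))
    have h3 := hx (f⁻¹ * x * f) h1 (by convert h2 using 1; group)
    convert h3 using 1
    group
  subst hUS
  rw [mem_conjFullSubgroup, hg]
  have hdl : d ∈ fullSubgroup Γ G (link Γ U) := mem_fullSubgroup_iInter hd
  exact mul_mem (mul_mem (fullSubgroup_mono Set.subset_union_left hs)
    (fullSubgroup_mono Set.subset_union_right hdl)) (fullSubgroup_mono Set.subset_union_left ht)

theorem union_link_ne_univ (hΓ : IsIrreducible Γ) {S : Set V} (hS : S.Nonempty)
    (hne : S ≠ Set.univ) : S ∪ link Γ S ≠ Set.univ := by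
  intro h
  have hdisj : Disjoint S (link Γ S) := by
    rw [Set.disjoint_left]
    intro v hv hl
    exact Γ.loopless.irrefl v (Set.mem_iInter₂.1 hl v hv)
  refine hΓ ⟨S, link Γ S, hS, ?_, hdisj, h, rfl⟩
  rw [Set.nonempty_iff_ne_empty]
  intro h0
  rw [h0, Set.union_empty] at h
  exact hne h

theorem star_ne_univ [Nontrivial V] (hΓ : IsIrreducible Γ) (v : V) : star Γ v ≠ Set.univ := by
  have h : star Γ v = {v} ∪ link Γ {v} := by
    ext t
    simp [star, link]
  rw [h]
  exact union_link_ne_univ hΓ (Set.singleton_nonempty v) (Set.singleton_ne_univ v)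

end Parabolic

/-! ### Tree metrics and group actions -/

/-- An integral metric `d` is a tree metric if it satisfies the four-point condition and any two
points are joined by a discrete geodesic. -/
structure IsTreeMetric {P : Type*} (d : P → P → ℤ) : Prop where
  self : ∀ x, d x x = 0
  symm : ∀ x y, d x y = d y x
  eq_of : ∀ x y, d x y = 0 → x = y
  four : ∀ x y z w, d x y + d z w ≤ max (d x z + d y w) (d x w + d y z)
  geod : ∀ x y n, 0 ≤ n → n ≤ d x y → ∃ z, d x z = n ∧ d z y = d x y - n

/-- An isometric action on a tree metric without inversions: every point is moved an even
distance. -/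
structure IsTreeAction (H : Type*) [Group H] {P : Type*} [MulAction H P] (d : P → P → ℤ) : Prop
    extends IsTreeMetric d where
  inv : ∀ (g : H) x y, d (g • x) (g • y) = d x y
  even : ∀ (g : H) x, Even (d x (g • x))

/-- The group element `g` fixes a point of `P`. -/
def FixesPoint {H : Type*} [Group H] (P : Type*) [MulAction H P] (g : H) : Prop :=
  ∃ x : P, g • x = x

namespace IsTreeMetric

variable {P : Type*} {d : P → P → ℤ} (hd : IsTreeMetric d)

include hd

theorem triangle (x y z : P) : d x z ≤ d x y + d y z := by
  have h := hd.four x z y y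
  rw [hd.self, hd.symm z y] at h
  omega

theorem nonneg (x y : P) : 0 ≤ d x y := by
  have h := hd.triangle x y x
  rw [hd.self, hd.symm y x] at h
  omega

/-- The geodesics from `p` to `y` and to `y'` agree up to distance `m` from `p` if the Gromov
product of `y` and `y'` based at `p` is at least `m`. -/
theorem eq_of_gromov {p y y' u u' : P} {m : ℤ} (hu : d p u = m) (huy : d u y = d p y - m)
    (hu' : d p u' = m) (huy' : d u' y' = d p y' - m) (h : d y y' ≤ d p y + d p y' - 2 * m) :
    u = u' := by
  apply hd.eq_of
  have h1 := hd.four u y' y p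
  have h2 := hd.four u u' y' p
  have e1 := hd.symm u p
  have e2 := hd.symm y p
  have e3 := hd.symm y' p
  have e4 := hd.symm u' p
  have e5 := hd.symm y y'
  have e6 := hd.symm y' u'
  have e7 := hd.nonneg u u'
  have e8 := hd.symm u y'
  omega

end IsTreeMetric

namespace IsTreeAction

variable {H : Type*} [Group H] {P : Type*} [MulAction H P] {d : P → P → ℤ}

theorem subgroup (hd : IsTreeAction H d) (K : Subgroup H) : IsTreeAction K d where
  toIsTreeMetric := hd.toIsTreeMetric
  inv g := hd.inv (g : H)
  even g := hd.even (g : H)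

variable (hd : IsTreeAction H d)

include hd

theorem dist_inv_smul (g : H) (x y : P) : d (g⁻¹ • x) y = d x (g • y) := by
  rw [← hd.inv g, smul_inv_smul]

theorem dist_lt_of_not_fixesPoint {g : H} (hg : ¬ FixesPoint P g) (x : P) :
    d x (g • x) < d x ((g * g) • x) := by
  by_contra! h
  obtain ⟨m, hm⟩ := hd.even g x
  have h0 := hd.nonneg x (g • x)
  -- The midpoint of `x` and `g • x` is fixed.
  obtain ⟨z, hz1, hz2⟩ := hd.geod x (g • x) m (by omega) (by omega)
  refine hg ⟨z, ?_⟩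
  rw [mul_smul] at h
  have e := hd.inv g x (g • x)
  refine (hd.eq_of_gromov (p := g • x) (y := x) (y' := g • g • x) (m := m) ?_ ?_ ?_ ?_ ?_).symm
  · rw [hd.symm]; omega
  · rw [hd.symm, hd.symm _ x]; omega
  · rw [hd.inv]; omega
  · rw [hd.inv]; omega
  · rw [hd.symm _ x]; omega

end IsTreeAction

/-- The orbit of `x` under `h` is a discrete quasi-axis: `h` translates by `τ` along its axis, and
`κ` is twice the distance from `x` to the axis. -/
structure IsAxial {H : Type*} [Group H] {P : Type*} [MulAction H P] (d : P → P → ℤ) (h : H)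
    (x : P) (τ κ : ℤ) : Prop where
  pos : 0 < τ
  nonneg : 0 ≤ κ
  pow : ∀ n : ℕ, 1 ≤ n → d x (h ^ n • x) = n * τ + κ

namespace IsTreeAction

variable {H : Type*} [Group H] {P : Type*} [MulAction H P] {d : P → P → ℤ}
  (hd : IsTreeAction H d)

include hd

/-- If `g * g` moves `x` further than `g` does, then the four-point condition forces the
displacement of `x` to grow by the same amount with every further power of `g`. -/
theorem isAxial_of_lt {g : H} {x : P} (h : d x (g • x) < d x ((g * g) • x)) :
    IsAxial d g x (d x ((g * g) • x) - d x (g • x)) (2 * d x (g • x) - d x ((g * g) • x)) := by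
  have e0 : d (g • x) ((g * g) • x) = d x (g • x) := by rw [mul_smul, hd.inv]
  have key : ∀ n : ℕ, d x (g ^ (n + 1) • x) =
      d x (g • x) + n * (d x ((g * g) • x) - d x (g • x)) ∧
      d x (g ^ (n + 2) • x) =
      d x (g • x) + (n + 1 : ℕ) * (d x ((g * g) • x) - d x (g • x)) := by
    intro n
    induction n with
    | zero => simp [pow_two]
    | succ n ih =>
      refine ⟨ih.2, ?_⟩
      have a1 := hd.four x (g ^ (n + 3) • x) (g • x) (g ^ (n + 2) • x)
      have a2 := hd.four x (g ^ (n + 2) • x) (g • x) (g ^ (n + 3) • x)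
      have e1 : d (g • x) (g ^ (n + 2) • x) = d x (g ^ (n + 1) • x) := by
        rw [pow_succ' g (n + 1), mul_smul, hd.inv]
      have e2 : d (g • x) (g ^ (n + 3) • x) = d x (g ^ (n + 2) • x) := by
        rw [pow_succ' g (n + 2), mul_smul, hd.inv]
      have e3 : d (g ^ (n + 2) • x) (g ^ (n + 3) • x) = d x (g • x) := by
        rw [pow_succ g (n + 2), mul_smul, hd.inv]
      have e4 := hd.symm (g ^ (n + 3) • x) (g • x)
      have e5 := hd.symm (g ^ (n + 2) • x) (g • x)
      have e6 := hd.symm (g ^ (n + 2) • x) (g ^ (n + 3) • x)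
      obtain ⟨i1, i2⟩ := ih
      have e7 : 0 ≤ (n : ℤ) * (d x ((g * g) • x) - d x (g • x)) :=
        mul_nonneg (by positivity) (by omega)
      push_cast at i2 ⊢
      rw [add_mul, one_mul] at i2
      rw [add_mul, one_mul, add_mul, one_mul]
      show d x (g ^ (n + 3) • x) = _
      omega
  refine ⟨by omega, ?_, fun n hn => ?_⟩
  · have := hd.triangle x (g • x) ((g * g) • x)
    omega
  · obtain ⟨m, rfl⟩ := Nat.exists_eq_add_of_le' hn
    rw [(key m).1]
    push_cast
    ring

theorem exists_isAxial {g : H} (hg : ¬ FixesPoint P g) (x : P) : ∃ τ κ, IsAxial d g x τ κ :=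
  ⟨_, _, hd.isAxial_of_lt (hd.dist_lt_of_not_fixesPoint hg x)⟩

theorem dist_pow_le_of_fixed {g : H} {p : P} (hp : g • p = p) (x : P) (n : ℕ) :
    d x (g ^ n • x) ≤ 2 * d x p := by
  have h : g ^ n • p = p := by
    induction n with
    | zero => simp
    | succ n ih => rw [pow_succ, mul_smul, hp, ih]
  have h1 := hd.triangle x p (g ^ n • x)
  have h2 : d p (g ^ n • x) = d p x := by
    conv_lhs => rw [← h]
    exact hd.inv _ _ _
  rw [h2, hd.symm p x] at h1
  omega

theorem not_fixesPoint_of_isAxial {g : H} {x : P} {τ κ : ℤ} (h : IsAxial d g x τ κ) :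
    ¬ FixesPoint P g := by
  rintro ⟨p, hp⟩
  have h0 := hd.nonneg x p
  have h1 := hd.dist_pow_le_of_fixed hp x ((2 * d x p).toNat + 1)
  rw [h.pow _ (by omega)] at h1
  have h2 := h.pos
  have h3 := h.nonneg
  push_cast at h1
  rw [Int.toNat_of_nonneg (by omega)] at h1
  nlinarith

/-- **Serre's lemma.** If the subgroup `A` and the element `b` have fixed points and so has every
product `a * b` with `a` in `A`, then `A` and `b` have a common fixed point. -/
theorem exists_common_fixed {A : Subgroup H} {b : H} (hA : ∃ p : P, ∀ a ∈ A, a • p = p)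
    (hb : FixesPoint P b) (hab : ∀ a ∈ A, FixesPoint P (a * b)) :
    ∃ p : P, (∀ a ∈ A, a • p = p) ∧ b • p = p := by
  classical
  have hex : ∃ n : ℕ, ∃ p q : P, (∀ a ∈ A, a • p = p) ∧ b • q = q ∧ (d p q).toNat = n := by
    obtain ⟨p, hp⟩ := hA
    obtain ⟨q, hq⟩ := hb
    exact ⟨_, p, q, hp, hq, rfl⟩
  -- Otherwise take fixed points `p` of `A` and `q` of `b` at the least distance `n`.
  obtain ⟨p, q, hp, hq, hn⟩ := Nat.find_spec hex
  have hmin : ∀ p' q' : P, (∀ a ∈ A, a • p' = p') → b • q' = q' → d p q ≤ d p' q' := by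
    intro p' q' hp' hq'
    have := Nat.find_min' hex ⟨p', q', hp', hq', rfl⟩
    have := hd.nonneg p q
    have := hd.nonneg p' q'
    omega
  by_cases h0 : d p q = 0
  · obtain rfl := hd.eq_of p q h0
    exact ⟨p, hp, hq⟩
  exfalso
  have hpos := hd.nonneg p q
  obtain ⟨p', hp1, hp2⟩ := hd.geod p q 1 (by omega) (by omega)
  have hqp := hd.symm q p
  obtain ⟨q', hq1, hq2⟩ := hd.geod q p 1 (by omega) (by omega)
  have ha : ∃ a ∈ A, a • p' ≠ p' := by
    by_contra! h
    have := hmin p' q h hq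
    omega
  obtain ⟨a, haA, hap⟩ := ha
  have hbq : b • q' ≠ q' := by
    intro h
    have := hmin p q' hp h
    have := hd.symm p q'
    omega
  have e1 : d p (a • q) = d p q := by
    conv_lhs => rw [← hp a haA]
    exact hd.inv _ _ _
  have e2 : d q (b • p) = d p q := by
    conv_lhs => rw [← hq]
    rw [hd.inv, hqp]
  -- The geodesics leaving `p` towards `q` and `a • q` diverge at once, by the choice of `a`.
  have f1 : d q (a • q) = 2 * d p q := by
    obtain ⟨k, hk⟩ := hd.even a q
    have t := hd.triangle q p (a • q)
    by_contra hne
    refine hap (hd.eq_of_gromov (p := p) (y := a • q) (y' := q) (m := 1) ?_ ?_ hp1 (by omega) ?_)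
    · conv_lhs => rw [← hp a haA]
      rw [hd.inv, hp1]
    · rw [hd.inv, e1]; omega
    · rw [hd.symm (a • q) q, e1]; omega
  have f2 : d p (b • p) = 2 * d p q := by
    obtain ⟨k, hk⟩ := hd.even b p
    have t := hd.triangle p q (b • p)
    by_contra hne
    refine hbq (hd.eq_of_gromov (p := q) (y := b • p) (y' := p) (m := 1) ?_ ?_ hq1 (by omega) ?_)
    · conv_lhs => rw [← hq]
      rw [hd.inv, hq1]
    · rw [hd.inv, e2]; omega
    · rw [hd.symm (b • p) p, e2]; omega
  -- Hence `a * b` is a translation.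
  have hlt : d q ((a * b) • q) < d q (((a * b) * (a * b)) • q) := by
    have g1 : (a * b) • q = a • q := by rw [mul_smul, hq]
    have g2 : ((a * b) * (a * b)) • q = a • b • a • q := by
      rw [mul_smul, g1, mul_smul]
    have w3 := hd.dist_inv_smul a q (b • a • q)
    rw [g1, g2]
    have u1 : d (a⁻¹ • q) p = d p q := by rw [hd.dist_inv_smul, hp a haA, hd.symm]
    have u2 : d (a⁻¹ • q) q = 2 * d p q := by rw [hd.dist_inv_smul, f1]
    have w1 : d q (b • a • q) = 2 * d p q := by
      have := hd.inv b q (a • q)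
      rwa [hq, f1] at this
    have w2 : d (b • p) (b • a • q) = d p q := by rw [hd.inv, e1]
    have a1 := hd.four p (b • p) q (b • a • q)
    have a2 := hd.four (a⁻¹ • q) q p (b • a • q)
    have s1 := hd.symm (b • p) q
    omega
  exact hd.not_fixesPoint_of_isAxial (hd.isAxial_of_lt hlt) (hab a haA)

/-! ### Ping-pong -/

/-- A local-to-global criterion: if the displacement of every letter exceeds `C` and consecutive
letters backtrack by at most `C / 2`, then reduced words move `x` by at least their length. -/
theorem norm_le_dist_lift (φ : Fin 2 → H) (x : P) (C : ℤ)
    (h1 : ∀ s : Fin 2 × Bool, C < d x (cond s.2 (φ s.1) (φ s.1)⁻¹ • x))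
    (h2 : ∀ s t : Fin 2 × Bool, (s.1 = t.1 → s.2 = t.2) →
      d x (cond s.2 (φ s.1) (φ s.1)⁻¹ • x) + d x (cond t.2 (φ t.1) (φ t.1)⁻¹ • x) -
        d x ((cond s.2 (φ s.1) (φ s.1)⁻¹ * cond t.2 (φ t.1) (φ t.1)⁻¹) • x) ≤ C)
    (w : FreeGroup (Fin 2)) : (w.norm : ℤ) ≤ d x (FreeGroup.lift φ w • x) := by
  set e : Fin 2 × Bool → H := fun s => cond s.2 (φ s.1) (φ s.1)⁻¹ with he
  have main : ∀ (L : List (Fin 2 × Bool)) (s : Fin 2 × Bool), FreeGroup.IsReduced (s :: L) →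
      ((s :: L).length : ℤ) ≤ d x (((s :: L).map e).prod • x) ∧
      d (e s • x) x + d (e s • x) (((s :: L).map e).prod • x) -
        d x (((s :: L).map e).prod • x) ≤ C := by
    intro L
    induction L with
    | nil =>
      intro s _
      have a1 := h1 s
      have a2 := h2 s s (fun _ => rfl)
      have a3 := hd.triangle x (e s • x) ((e s * e s) • x)
      have a4 : d (e s • x) ((e s * e s) • x) = d x (e s • x) := by rw [mul_smul, hd.inv]
      have a5 := hd.self (e s • x)
      have a6 := hd.symm (e s • x) x
      simp only [List.map_cons, List.map_nil, List.prod_cons, List.prod_nil, mul_one,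
        List.length_cons, List.length_nil]
      change C < d x (e s • x) at a1
      change d x (e s • x) + d x (e s • x) - d x ((e s * e s) • x) ≤ C at a2
      constructor <;> push_cast <;> omega
    | cons t L ih =>
      intro s hs
      rw [FreeGroup.isReduced_cons_cons] at hs
      obtain ⟨i1, i2⟩ := ih t hs.2
      rw [List.map_cons, List.prod_cons, mul_smul]
      set y := ((t :: L).map e).prod • x
      have a1 := h1 t
      have a1' := h1 s
      have a2 := h2 s t hs.1
      change C < d x (e t • x) at a1
      change C < d x (e s • x) at a1'
      change d x (e s • x) + d x (e t • x) - d x ((e s * e t) • x) ≤ C at a2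
      rw [mul_smul, ← hd.dist_inv_smul (e s) x (e t • x)] at a2
      rw [hd.inv, ← hd.dist_inv_smul]
      have a3 : d (e s • x) x = d x (e s • x) := hd.symm _ _
      have a4 : d ((e s)⁻¹ • x) x = d x (e s • x) := hd.dist_inv_smul _ _ _
      have a5 := hd.four ((e s)⁻¹ • x) (e t • x) y x
      have a6 := hd.symm (e t • x) x
      have a7 := hd.symm y x
      rw [List.length_cons]
      constructor <;> push_cast <;> omega
  have hw : FreeGroup.lift φ w = (w.toWord.map e).prod := by
    conv_lhs => rw [← FreeGroup.mk_toWord (x := w)]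
    rw [FreeGroup.lift_mk]
  rw [hw, FreeGroup.norm]
  have hred := FreeGroup.isReduced_toWord (x := w)
  cases hL : w.toWord with
  | nil => simp [hd.self]
  | cons s L =>
    rw [hL] at hred
    exact (main L s hred).1

/-- If reduced words move `x` by at least their length, then no nontrivial element of the free
group fixes a point, since its powers are infinitely many. -/
theorem not_fixesPoint_of_norm_le {f : FreeGroup (Fin 2) →* H} {x : P}
    (h : ∀ w : FreeGroup (Fin 2), (w.norm : ℤ) ≤ d x (f w • x)) {w : FreeGroup (Fin 2)}
    (hw : w ≠ 1) : ¬ FixesPoint P (f w) := by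
  rintro ⟨p, hp⟩
  have hb : ∀ n : ℕ, (w ^ n).toWord.length ≤ (2 * d x p).toNat := by
    intro n
    have h1 := h (w ^ n)
    have h2 := hd.dist_pow_le_of_fixed hp x n
    rw [map_pow] at h1
    rw [FreeGroup.norm] at h1
    omega
  have hinj : Function.Injective fun n : ℕ => (w ^ n).toWord :=
    FreeGroup.toWord_injective.comp (IsMulTorsionFree.pow_right_injective hw)
  have hfin := List.finite_length_le (Fin 2 × Bool) (2 * d x p).toNat
  exact Set.infinite_univ (hfin.preimage hinj.injOn |>.subset fun n _ => hb n)

end IsTreeAction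

/-! ### Groups acting on a set of ends -/

section Ends

variable {H : Type*} [Group H] {E : Type*} [MulAction H E]

/-- Suppose that every translate of the pair `e`, `e'` meets the pair, and that `h` fixes both
points and no other point of a translate. If some `k` carries one of them to `e` and the other one
out of the pair, then the whole group fixes `e`. -/
theorem forall_smul_eq_of_smul_ne {e e' p q : E} {h k : H} (hne : e ≠ e')
    (h1 : ∀ m : H, m • e = e ∨ m • e = e' ∨ m • e' = e ∨ m • e' = e')
    (h2 : ∀ (m : H) (y : E), y = e ∨ y = e' → h • m • y = m • y → m • y = e ∨ m • y = e')
    (he : h • e = e) (he' : h • e' = e') (hpq : p = e ∧ q = e' ∨ p = e' ∧ q = e) (hp : k • p = e)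
    (hq : k • q ≠ e) (hq' : k • q ≠ e') : ∀ m : H, m • e = e := by
  have claim : ∀ m : H, m • e = e ∨ m • e' = e := by
    intro m
    by_contra! hm
    -- The translate of the pair by `m` has one point `e'`; the other one, `m • r`, would be both
    -- `k • q` and `h • k • q`.
    have hr : ∃ r, (r = e ∨ r = e') ∧ ∀ y, y = e ∨ y = e' → m • y ≠ m • r → m • y = e' := by
      rcases h1 m with h | h | h | h
      · exact absurd h hm.1
      · exact ⟨e', Or.inr rfl, by rintro y (rfl | rfl) hy; exacts [h, absurd rfl hy]⟩
      · exact absurd h hm.2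
      · exact ⟨e, Or.inl rfl, by rintro y (rfl | rfl) hy; exacts [absurd rfl hy, h]⟩
    obtain ⟨r, -, hr⟩ := hr
    have key : ∀ c : E, c ≠ e' → ∀ g : H, g • p = e → g • q = c → m • r = c := by
      intro c hc g hgp hgq
      have hy : ∃ y, (y = e ∨ y = e') ∧ (m • y = e ∨ m • y = c) := by
        have h3 : ∀ y, (g⁻¹ * m) • y = e ∨ (g⁻¹ * m) • y = e' → m • y = e ∨ m • y = c := by
          intro y hy
          rw [mul_smul, inv_smul_eq_iff, inv_smul_eq_iff] at hy
          rcases hpq with ⟨rfl, rfl⟩ | ⟨rfl, rfl⟩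
          · rwa [hgp, hgq] at hy
          · rw [hgp, hgq] at hy
            exact hy.symm
        rcases h1 (g⁻¹ * m) with h | h | h | h
        · exact ⟨e, Or.inl rfl, h3 e (Or.inl h)⟩
        · exact ⟨e, Or.inl rfl, h3 e (Or.inr h)⟩
        · exact ⟨e', Or.inr rfl, h3 e' (Or.inl h)⟩
        · exact ⟨e', Or.inr rfl, h3 e' (Or.inr h)⟩
      obtain ⟨y, hye, hy⟩ := hy
      have hyc : m • y = c := by
        rcases hy with hy | hy
        · rcases hye with rfl | rfl
          · exact absurd hy hm.1
          · exact absurd hy hm.2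
        · exact hy
      by_contra hrc
      exact hc (hyc.symm.trans (hr y hye (by rw [hyc]; exact Ne.symm hrc)))
    have hqe : q = e ∨ q = e' := by tauto
    have k1 := key (k • q) hq' k hp rfl
    have hce : h • k • q ≠ e' := by
      rw [← he']
      exact fun h3 => hq' (smul_left_cancel h h3)
    have k2 := key (h • k • q) hce (h * k) (by rw [mul_smul, hp, he]) (by rw [mul_smul])
    rcases h2 k q hqe (k2.symm.trans k1) with h4 | h4
    · exact hq h4
    · exact hq' h4
  have orbit : ∀ m : H, m • e = e ∨ m • e = e' := by
    intro m
    rcases claim m⁻¹ with h | h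
    · exact Or.inl (inv_smul_eq_iff.1 h).symm
    · exact Or.inr (inv_smul_eq_iff.1 h).symm
  intro m
  refine (orbit m).resolve_right fun hm => ?_
  rcases hpq with ⟨rfl, rfl⟩ | ⟨rfl, rfl⟩
  · have := orbit (k * m)
    rw [mul_smul, hm] at this
    tauto
  · have := orbit k
    tauto

/-- If every translate of the pair of ends `a`, `b` of a hyperbolic element meets this pair, then
the group fixes one of the two ends or preserves the pair. -/
theorem fixes_end_or_preserves_pair {a b : E} {h : H} (hab : a ≠ b) (ha : h • a = a)
    (hb : h • b = b) (h1 : ∀ m : H, m • a = a ∨ m • a = b ∨ m • b = a ∨ m • b = b)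
    (h2 : ∀ (m : H) (y : E), y = a ∨ y = b → h • m • y = m • y → m • y = a ∨ m • y = b) :
    (∀ m : H, m • a = a) ∨ (∀ m : H, m • b = b) ∨
      ∀ m : H, m • a = a ∧ m • b = b ∨ m • a = b ∧ m • b = a := by
  by_contra! hcon
  obtain ⟨⟨m1, hm1⟩, ⟨m2, hm2⟩, k, hk1, hk2⟩ := hcon
  have h1' : ∀ m : H, m • b = b ∨ m • b = a ∨ m • a = b ∨ m • a = a := fun m => by
    have := h1 m
    tauto
  have h2' : ∀ (m : H) (y : E), y = b ∨ y = a → h • m • y = m • y → m • y = b ∨ m • y = a :=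
    fun m y hy h => (h2 m y hy.symm h).symm
  have hinj : k • a ≠ k • b := fun h => hab (smul_left_cancel k h)
  rcases h1 k with h | h | h | h
  · exact hm1 (forall_smul_eq_of_smul_ne hab h1 h2 ha hb (Or.inl ⟨rfl, rfl⟩) h
      (fun h' => hinj (h.trans h'.symm)) (hk1 h) m1)
  · exact hm2 (forall_smul_eq_of_smul_ne hab.symm h1' h2' hb ha (Or.inr ⟨rfl, rfl⟩) h
      (fun h' => hinj (h.trans h'.symm)) (hk2 h) m2)
  · exact hm1 (forall_smul_eq_of_smul_ne hab h1 h2 ha hb (Or.inr ⟨rfl, rfl⟩) h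
      (fun h' => hinj (h'.trans h.symm)) (fun h' => hk2 h' h) m1)
  · exact hm2 (forall_smul_eq_of_smul_ne hab.symm h1' h2' hb ha (Or.inl ⟨rfl, rfl⟩) h
      (fun h' => hinj (h'.trans h.symm)) (fun h' => hk1 h' h) m2)

end Ends

/-! ### Infinite cyclic and infinite dihedral groups -/

section Cyclic

theorem nonempty_mulEquiv_int {K : Type*} [Group K] {β : K →* Multiplicative ℤ}
    (hβ : Function.Injective β) {h : K} (hh : β h ≠ 1) : Nonempty (K ≃* Multiplicative ℤ) := by
  have : IsCyclic K := isCyclic_of_injective β hβ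
  have : Infinite K := Infinite.of_injective (fun n : ℕ => h ^ n) fun i j hij =>
    IsMulTorsionFree.pow_right_injective hh (by
      have := congrArg β hij
      simpa only [map_pow] using this)
  exact ⟨intCyclicMulEquiv.symm⟩

theorem conj_zpow_eq {H : Type*} [Group H] {z t : H} (htz : t * z * t⁻¹ = z⁻¹) (i : ℤ) :
    z ^ i * t = t * z ^ (-i) := by
  have h := conj_zpow (a := t) (b := z) (i := -i)
  rw [htz, inv_zpow, zpow_neg, inv_inv, eq_mul_inv_iff_mul_eq] at h
  rw [h, zpow_neg]

/-- A recognition criterion for the infinite dihedral group. -/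
theorem nonempty_mulEquiv_dihedralGroup {H : Type*} [Group H] {z t : H}
    (hz : ∀ i : ℤ, z ^ i = 1 → i = 0) (hcov : ∀ g, (∃ i : ℤ, g = z ^ i) ∨ ∃ i : ℤ, g = t * z ^ i)
    (ht : ∀ i : ℤ, t ≠ z ^ i) (htt : t * t = 1) (htz : t * z * t⁻¹ = z⁻¹) :
    Nonempty (H ≃* DihedralGroup 0) := by
  have hzinj : ∀ i j : ℤ, z ^ i = z ^ j → i = j := fun i j h => by
    have := hz (i - j) (by rw [zpow_sub, h, mul_inv_cancel])
    omega
  let p : ℤ → H := fun i => z ^ i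
  let q : ℤ → H := fun i => t * z ^ i
  have hpp : ∀ i j, p (i + j) = p i * p j := zpow_add z
  have hpq : ∀ i j, q (j - i) = p i * q j := fun i j => by
    change t * z ^ (j - i) = z ^ i * (t * z ^ j)
    rw [← mul_assoc, conj_zpow_eq htz, mul_assoc, ← zpow_add, neg_add_eq_sub]
  have hqp : ∀ i j, q (i + j) = q i * p j := fun i j => by
    change t * z ^ (i + j) = t * z ^ i * z ^ j
    rw [mul_assoc, ← zpow_add]
  have hqq : ∀ i j, p (j - i) = q i * q j := fun i j => by
    change z ^ (j - i) = t * z ^ i * (t * z ^ j)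
    rw [mul_assoc, ← mul_assoc (z ^ i), conj_zpow_eq htz, mul_assoc t, ← mul_assoc t t,
      htt, one_mul, ← zpow_add, neg_add_eq_sub]
  have hpq' : ∀ i j, p i ≠ q j := fun i j h => ht (i - j) (by
    have h' : z ^ i = t * z ^ j := h
    rw [zpow_sub, h', mul_inv_cancel_right])
  let f : DihedralGroup 0 → H := fun x => match x with
    | .r i => p i
    | .sr i => q i
  have hmul : ∀ x y, f (x * y) = f x * f y := by
    rintro (i | i) (j | j)
    exacts [hpp i j, hpq i j, hqp i j, hqq i j]
  refine ⟨(MulEquiv.ofBijective (MonoidHom.mk' f hmul) ⟨?_, ?_⟩).symm⟩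
  · rintro (i | i) (j | j) h
    · exact congrArg DihedralGroup.r (hzinj i j h)
    · exact absurd h (hpq' i j)
    · exact absurd (Eq.symm h) (hpq' j i)
    · exact congrArg DihedralGroup.sr (hzinj i j (mul_left_cancel (a := t) h))
  · intro g
    rcases hcov g with ⟨i, rfl⟩ | ⟨i, rfl⟩
    · exact ⟨DihedralGroup.r (n := 0) i, rfl⟩
    · exact ⟨DihedralGroup.sr (n := 0) i, rfl⟩

/-- A group with an infinite cyclic subgroup `K` of index two is infinite dihedral if some element
outside `K` does not centralise `K`. -/
theorem nonempty_mulEquiv_dihedralGroup_of_index_two {H : Type*} [Group H] {K : Subgroup H}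
    (φ : K ≃* Multiplicative ℤ) {t h : H} (ht : t ∉ K) (hcov : ∀ g, g ∉ K → t⁻¹ * g ∈ K)
    (hconj : ∀ k ∈ K, t * k * t⁻¹ ∈ K) (hh : h ∈ K) (hth : t * h * t⁻¹ ≠ h) :
    Nonempty (H ≃* DihedralGroup 0) := by
  set z : H := ((φ.symm (Multiplicative.ofAdd 1) : K) : H) with hzdef
  have hpow : ∀ i : ℤ, z ^ i = φ.symm (Multiplicative.ofAdd i) := by
    intro i
    rw [hzdef, ← Subgroup.coe_zpow, ← map_zpow, ← ofAdd_zsmul]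
    simp
  have hzK : ∀ k ∈ K, ∃ i : ℤ, k = z ^ i := fun k hk =>
    ⟨Multiplicative.toAdd (φ ⟨k, hk⟩), by rw [hpow]; simp⟩
  have hzmem : ∀ i : ℤ, z ^ i ∈ K := fun i => by rw [hpow]; exact SetLike.coe_mem _
  have hz : ∀ i : ℤ, z ^ i = 1 → i = 0 := by
    intro i hi
    rw [hpow, OneMemClass.coe_eq_one] at hi
    simpa using hi
  have hzinj : ∀ i j : ℤ, z ^ i = z ^ j → i = j := fun i j h => by
    have := hz (i - j) (by rw [zpow_sub, h, mul_inv_cancel])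
    omega
  have htt : t * t ∈ K := by
    by_contra hn
    have := hcov _ hn
    rw [inv_mul_cancel_left] at this
    exact ht this
  obtain ⟨c, hc⟩ := hzK _ htt
  obtain ⟨m, hm⟩ := hzK _ (hconj z (by simpa using hzmem 1))
  have hconjpow : ∀ i : ℤ, t * z ^ i * t⁻¹ = z ^ (m * i) := fun i => by
    rw [← conj_zpow, hm, zpow_mul]
  -- Conjugation by `t` is an involution of `K`, since `t * t` lies in `K`.
  have hmm : m * m = 1 := by
    have h1 := hconjpow m
    rw [← hm] at h1
    have h2 : t * (t * z * t⁻¹) * t⁻¹ = (t * t) * z * (t * t)⁻¹ := by group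
    rw [h2, hc] at h1
    refine hzinj _ _ (h1.symm.trans ?_)
    group
  have hm1 : m = -1 := by
    rcases Int.mul_eq_one_iff_eq_one_or_neg_one.1 hmm with ⟨h1, -⟩ | ⟨h1, -⟩
    · obtain ⟨j, rfl⟩ := hzK h hh
      rw [hconjpow, h1, one_mul] at hth
      exact absurd rfl hth
    · exact h1
  have hc0 : c = 0 := by
    have h1 := hconjpow c
    rw [← hc] at h1
    have h2 : t * (t * t) * t⁻¹ = t * t := by group
    rw [h2, hc] at h1
    have := hzinj _ _ h1
    subst hm1
    omega
  refine nonempty_mulEquiv_dihedralGroup (z := z) (t := t) hz (fun g => ?_)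
    (fun i hi => ht (hi ▸ hzmem i)) (by rw [hc, hc0, zpow_zero]) (by rw [hm, hm1, zpow_neg_one])
  by_cases hg : g ∈ K
  · exact Or.inl (hzK g hg)
  · obtain ⟨i, hi⟩ := hzK _ (hcov g hg)
    exact Or.inr ⟨i, by rw [← hi, mul_inv_cancel_left]⟩

end Cyclic

/-! ### Axes and ends -/

namespace IsTreeAction

universe v

variable {H : Type*} [Group H] {P : Type v} [MulAction H P] {d : P → P → ℤ}
  (hd : IsTreeAction H d)

include hd

theorem isAxial_inv {h : H} {x : P} {τ κ : ℤ} (hh : IsAxial d h x τ κ) : IsAxial d h⁻¹ x τ κ where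
  pos := hh.pos
  nonneg := hh.nonneg
  pow n hn := by rw [inv_pow, hd.symm, hd.dist_inv_smul, hh.pow n hn]

theorem dist_pow_pow {h : H} {x : P} {τ κ : ℤ} (hh : IsAxial d h x τ κ) {m n : ℕ} (hmn : m < n) :
    d (h ^ m • x) (h ^ n • x) = n * τ - m * τ + κ := by
  obtain ⟨k, rfl⟩ := Nat.exists_eq_add_of_le hmn.le
  rw [pow_add, mul_smul, hd.inv, hh.pow k (by omega)]
  push_cast
  ring

theorem dist_pow_le {h : H} {x : P} {τ κ : ℤ} (hh : IsAxial d h x τ κ) {m n : ℕ} (hmn : m ≤ n) :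
    d x (h ^ m • x) ≤ n * τ + κ := by
  have h1 : (m : ℤ) * τ ≤ n * τ := mul_le_mul_of_nonneg_right (by exact_mod_cast hmn) hh.pos.le
  rcases Nat.eq_zero_or_pos m with rfl | hm
  · have := hh.nonneg
    simp only [pow_zero, one_smul, hd.self]
    push_cast at h1
    omega
  · rw [hh.pow m hm]
    omega

/-- If two rays of the same speed have unbounded Gromov products, then they stay at bounded
distance from each other. -/
theorem exists_bound_of_gromov {e f k : H} {x : P} {τ κ : ℤ} (he : IsAxial d e x τ κ)
    (hf : IsAxial d f x τ κ)
    (h : ∀ C, ∃ M N : ℕ, C ≤ d x (e ^ M • x) + d x (k • f ^ N • x) -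
      d (e ^ M • x) (k • f ^ N • x)) :
    ∃ B, ∀ n : ℕ, d (e ^ n • x) (k • f ^ n • x) ≤ B := by
  refine ⟨κ + d x (k • x), fun n => ?_⟩
  have hκ := he.nonneg
  rcases Nat.eq_zero_or_pos n with rfl | hn
  · simp only [pow_zero, one_smul]
    omega
  obtain ⟨M, N, hMN⟩ := h (2 * (n * τ + κ) + 2 * d x (k • x) + 1)
  have hδ := hd.nonneg x (k • x)
  have e1 : ∀ m : ℕ, d (k • x) (k • f ^ m • x) = d x (f ^ m • x) := fun m => hd.inv _ _ _
  have hnM : n < M := by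
    by_contra! hle
    have h1 := hd.dist_pow_le he hle
    have h2 := hd.triangle x (e ^ M • x) (k • f ^ N • x)
    omega
  have hnN : n < N := by
    by_contra! hle
    have h1 := hd.dist_pow_le hf hle
    have h2 := hd.triangle x (k • f ^ N • x) (e ^ M • x)
    have h3 := hd.triangle x (k • x) (k • f ^ N • x)
    rw [e1] at h3
    rw [hd.symm (k • f ^ N • x)] at h2
    omega
  have a1 := he.pow n hn
  have a2 := he.pow M (by omega)
  have a3 := hd.dist_pow_pow he hnM
  have b1 := hf.pow n hn
  have b2 := hf.pow N (by omega)
  have b3 : d (k • f ^ n • x) (k • f ^ N • x) = N * τ - n * τ + κ := by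
    rw [hd.inv, hd.dist_pow_pow hf hnN]
  have c1 := hd.triangle x (k • x) (k • f ^ n • x)
  have c2 := hd.triangle (k • x) x (k • f ^ N • x)
  rw [e1] at c1 c2
  have f1 := hd.four (e ^ n • x) (k • f ^ N • x) (e ^ M • x) x
  have f2 := hd.four (e ^ n • x) (k • f ^ n • x) (k • f ^ N • x) x
  have s1 := hd.symm (k • f ^ N • x) (k • f ^ n • x)
  have s2 := hd.symm x (k • x)
  have s3 := hd.symm x (e ^ n • x)
  have s4 := hd.symm x (e ^ M • x)
  have s5 := hd.symm x (k • f ^ n • x)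
  have s6 := hd.symm x (k • f ^ N • x)
  have s7 := hd.symm (k • f ^ N • x) (e ^ M • x)
  have hnτ : 0 ≤ (n : ℤ) * τ := mul_nonneg (by positivity) he.pos.le
  omega

/-- Either large powers of `h` and of its conjugate by `k` play ping-pong, or an end of the axis of
`h` is carried by `k` to an end of the same axis. -/
theorem pingpong_or_bounded {h k : H} {x : P} {τ κ : ℤ} (hh : IsAxial d h x τ κ) :
    (∃ f : FreeGroup (Fin 2) →* H, ∀ w, w ≠ 1 → ¬ FixesPoint P (f w)) ∨
      ∃ s t : Bool, ∃ B, ∀ n : ℕ,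
        d ((cond s h h⁻¹) ^ n • x) (k • (cond t h h⁻¹) ^ n • x) ≤ B := by
  have hax : ∀ s : Bool, IsAxial d (cond s h h⁻¹) x τ κ := by
    rintro (_ | _)
    exacts [hd.isAxial_inv hh, hh]
  by_cases hbdd : ∃ s t : Bool, ∀ C, ∃ M N : ℕ, C ≤ d x ((cond s h h⁻¹) ^ M • x) +
      d x (k • (cond t h h⁻¹) ^ N • x) -
        d ((cond s h h⁻¹) ^ M • x) (k • (cond t h h⁻¹) ^ N • x)
  · obtain ⟨s, t, hst⟩ := hbdd
    exact Or.inr ⟨s, t, hd.exists_bound_of_gromov (hax s) (hax t) hst⟩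
  left
  push Not at hbdd
  choose c hc using hbdd
  -- `C` bounds all four Gromov products.
  obtain ⟨C, hC⟩ : ∃ C, ∀ s t, c s t ≤ C :=
    ⟨max (max (c true true) (c true false)) (max (c false true) (c false false)), by
      rintro (_ | _) (_ | _) <;> simp⟩
  have hκ := hh.nonneg
  have hτ := hh.pos
  set δ := d x (k • x) with hδdef
  have hδ : 0 ≤ δ := hd.nonneg _ _
  set D := |C| + κ + 10 * δ with hD
  have hC0 := le_abs_self C
  have hC1 := abs_nonneg C
  set N : ℕ := (D + 10 * δ).toNat + 1 with hN
  have hN1 : 1 ≤ N := by omega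
  have hNτ : D + 10 * δ < N * τ := by
    have : (N : ℤ) ≤ N * τ := le_mul_of_one_le_right (by positivity) hτ
    omega
  -- The two generators are `h ^ N` and `k * h ^ N * k⁻¹`.
  set E : Bool → H := fun s => (cond s h h⁻¹) ^ N with hE
  have hEinv : ∀ s, (E s)⁻¹ = E (!s) := by rintro (_ | _) <;> simp [E]
  have hL : ∀ s, d x (E s • x) = N * τ + κ := fun s => (hax s).pow N hN1
  have hLL : ∀ s, d x ((E s * E s) • x) = 2 * (N * τ) + κ := by
    intro s
    simp only [E]
    rw [← pow_add, (hax s).pow _ (by omega)]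
    push_cast
    ring
  have hcr : ∀ s t, d x (E s • x) + d x (k • E t • x) - d (E s • x) (k • E t • x) ≤ C :=
    fun s t => (hc s t N N).le.trans (hC s t)
  have hδ' : d (k⁻¹ • x) x = δ := hd.dist_inv_smul _ _ _
  have hconj : ∀ g y, d y ((k * g * k⁻¹) • x) ≤ d y (k • g • x) + δ ∧
      d y (k • g • x) ≤ d y ((k * g * k⁻¹) • x) + δ := by
    intro g y
    have e1 : d (k • g • k⁻¹ • x) (k • g • x) = δ := by rw [hd.inv, hd.inv, hδ']
    have t1 := hd.triangle y (k • g • k⁻¹ • x) (k • g • x)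
    have t2 := hd.triangle y (k • g • x) (k • g • k⁻¹ • x)
    have s1 := hd.symm (k • g • x) (k • g • k⁻¹ • x)
    simp only [mul_smul]
    constructor <;> omega
  have hkx : ∀ g : H, d x (k • g • x) ≤ d x (g • x) + δ ∧ d x (g • x) ≤ d x (k • g • x) + δ := by
    intro g
    have e1 : d (k • x) (k • g • x) = d x (g • x) := hd.inv _ _ _
    have t1 := hd.triangle x (k • x) (k • g • x)
    have t2 := hd.triangle (k • x) x (k • g • x)
    have s1 := hd.symm (k • x) x
    constructor <;> omega
  set φ : Fin 2 → H := ![h ^ N, k * h ^ N * k⁻¹] with hφ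
  have hφ0 : ∀ s : Bool, cond s (φ 0) (φ 0)⁻¹ = E s := by
    rintro (_ | _) <;> simp [φ, E]
  have hφ1 : ∀ s : Bool, cond s (φ 1) (φ 1)⁻¹ = k * E s * k⁻¹ := by
    rintro (_ | _) <;> simp [φ, E, mul_assoc]
  have hnorm := hd.norm_le_dist_lift φ x D ?_ ?_
  · exact ⟨FreeGroup.lift φ, fun w hw => hd.not_fixesPoint_of_norm_le hnorm hw⟩
  · rintro ⟨i, s⟩
    have h1 := hL s
    have h2 := hkx (E s)
    have h3 := hconj (E s) x
    fin_cases i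
    · simp only [Fin.zero_eta, hφ0]
      omega
    · simp only [Fin.mk_one, hφ1]
      omega
  · rintro ⟨i, s⟩ ⟨j, t⟩ hst
    have hs := hL s
    have ht := hL t
    have hs' := hkx (E s)
    have ht' := hkx (E t)
    have hs'' := hconj (E s) x
    have ht'' := hconj (E t) x
    fin_cases i <;> fin_cases j
    · obtain rfl : s = t := hst rfl
      simp only [Fin.zero_eta, hφ0]
      have := hLL s
      omega
    · simp only [Fin.zero_eta, Fin.mk_one, hφ0, hφ1]
      have h1 := hcr (!s) t
      have h2 := hL (!s)
      have h3 := hconj (E t) (E (!s) • x)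
      have h4 : d x ((E s * (k * E t * k⁻¹)) • x) = d (E (!s) • x) ((k * E t * k⁻¹) • x) := by
        rw [mul_smul, ← hEinv, hd.dist_inv_smul]
      omega
    · simp only [Fin.zero_eta, Fin.mk_one, hφ0, hφ1]
      have h1 := hcr t (!s)
      have h2 := hL (!s)
      have h2' := hkx (E (!s))
      have h3 := hconj (E (!s)) (E t • x)
      have h4 : d x ((k * E s * k⁻¹ * E t) • x) = d (E t • x) ((k * E (!s) * k⁻¹) • x) := by
        rw [mul_smul, ← hd.dist_inv_smul, hd.symm, ← hEinv]
        congr 2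
        group
      omega
    · obtain rfl : s = t := hst rfl
      simp only [Fin.mk_one, hφ1]
      have h1 := hLL s
      have h2 := hkx (E s * E s)
      have h3 := hconj (E s * E s) x
      have h4 : k * E s * k⁻¹ * (k * E s * k⁻¹) = k * (E s * E s) * k⁻¹ := by group
      rw [h4]
      omega

theorem dist_pow_smul_le {h : H} {y : P} {B : ℤ} (hB : d (h • y) y ≤ B) (j : ℕ) :
    d y (h ^ j • y) ≤ j * B := by
  induction j with
  | zero => simp [hd.self]
  | succ j ih =>
    have t := hd.triangle y (h ^ j • y) (h ^ (j + 1) • y)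
    have e : d (h ^ j • y) (h ^ (j + 1) • y) = d (h • y) y := by
      rw [pow_succ, mul_smul, hd.inv, hd.symm]
    push_cast
    rw [add_mul, one_mul]
    omega

/-- A hyperbolic element fixes no ends other than those of its axis. -/
theorem bounded_of_fixes_end {h f k : H} {x : P} {τ κ : ℤ} (hh : IsAxial d h x τ κ)
    (hf : IsAxial d f x τ κ)
    (hfix : ∃ B, ∀ n : ℕ, d (h • k • f ^ n • x) (k • f ^ n • x) ≤ B) :
    ∃ s : Bool, ∃ B, ∀ n : ℕ, d ((cond s h h⁻¹) ^ n • x) (k • f ^ n • x) ≤ B := by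
  have hax : ∀ s : Bool, IsAxial d (cond s h h⁻¹) x τ κ := by
    rintro (_ | _)
    exacts [hd.isAxial_inv hh, hh]
  by_cases hbdd : ∃ s : Bool, ∀ C, ∃ M N : ℕ, C ≤ d x ((cond s h h⁻¹) ^ M • x) +
      d x (k • f ^ N • x) - d ((cond s h h⁻¹) ^ M • x) (k • f ^ N • x)
  · obtain ⟨s, hs⟩ := hbdd
    exact ⟨s, hd.exists_bound_of_gromov (hax s) hf hs⟩
  exfalso
  push Not at hbdd
  choose c hc using hbdd
  obtain ⟨B, hB⟩ := hfix
  set C := |c true| + |c false| with hC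
  have hc1 := le_abs_self (c true)
  have hc2 := le_abs_self (c false)
  have hc3 := abs_nonneg (c true)
  have hc4 := abs_nonneg (c false)
  have hκ := hh.nonneg
  have hτ := hh.pos
  have hδ := hd.nonneg x (k • x)
  -- `h ^ j` moves `x` further than the Gromov products allow to be undone.
  set j : ℕ := C.toNat + 1 with hj
  have hjτ : C < j * τ := by
    have : (j : ℤ) ≤ j * τ := le_mul_of_one_le_right (by positivity) hτ
    omega
  have hB0 := (hd.nonneg _ _).trans (hB 0)
  have hjB : 0 ≤ (j : ℤ) * B := mul_nonneg (by positivity) hB0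
  set n : ℕ := (j * B + 2 * C + d x (k • x)).toNat + 1 with hn
  have hnτ : j * B + 2 * C + d x (k • x) < n * τ := by
    have : (n : ℤ) ≤ n * τ := le_mul_of_one_le_right (by positivity) hτ
    omega
  set y := k • f ^ n • x with hy
  have h1 := hd.dist_pow_smul_le (hB n) j
  have h2 := hc true j n
  have h3 := hc false j n
  simp only [cond_true, cond_false] at h2 h3
  rw [← hy] at h1 h2 h3
  have e1 : d (h⁻¹ ^ j • x) y = d x (h ^ j • y) := by rw [inv_pow, hd.dist_inv_smul]
  have e2 := hh.pow j (by omega)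
  have e3 := (hd.isAxial_inv hh).pow j (by omega)
  have e4 : d (h ^ j • x) (h ^ j • y) = d x y := hd.inv _ _ _
  have e5 : d (k • x) y = n * τ + κ := by rw [hy, hd.inv, hf.pow n (by omega)]
  have e6 := hd.triangle (k • x) x y
  have f1 := hd.four y (h ^ j • x) x (h ^ j • y)
  have s1 := hd.symm y (h ^ j • x)
  have s2 := hd.symm y x
  have s3 := hd.symm (h ^ j • x) x
  have s4 := hd.symm x (k • x)
  have s5 := hd.symm (h ^ j • x) (h ^ j • y)
  omega

/-! ### The Busemann homomorphism -/

/-- The Busemann function of the end of the ray `h ^ n • x` exists: the difference of the distances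
from `y` and from `x` to the points of the ray is eventually constant. -/
theorem exists_busemann {h : H} {x : P} {τ κ : ℤ} (hh : IsAxial d h x τ κ) (y : P) :
    ∃ c : ℤ, ∃ n₀ : ℕ, ∀ n ≥ n₀, d y (h ^ n • x) - d x (h ^ n • x) = c := by
  have hτ := hh.pos
  have hκ := hh.nonneg
  set n₀ : ℕ := (d x y).toNat + 1 with hn
  have hn0 : d x y < n₀ * τ := by
    have : (n₀ : ℤ) ≤ n₀ * τ := le_mul_of_one_le_right (by positivity) hτ
    omega
  refine ⟨d y (h ^ n₀ • x) - d x (h ^ n₀ • x), n₀, fun n hn' => ?_⟩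
  rcases hn'.lt_or_eq with hlt | rfl
  · have a1 := hd.dist_pow_pow hh hlt
    have a2 := hh.pow n₀ (by omega)
    have a3 := hh.pow n (by omega)
    have f1 := hd.four y (h ^ n • x) x (h ^ n₀ • x)
    have f2 := hd.four y (h ^ n₀ • x) x (h ^ n • x)
    have s1 := hd.symm (h ^ n • x) (h ^ n₀ • x)
    have s2 := hd.symm x y
    have s3 := hd.symm (h ^ n • x) x
    have s4 := hd.symm (h ^ n₀ • x) x
    have t1 := hd.triangle x y (h ^ n₀ • x)
    have t2 := hd.triangle x y (h ^ n • x)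
    omega
  · rfl

/-- If a group fixes an end of the axis of one of its elements, then the Busemann function of that
end gives a homomorphism to `ℤ` whose kernel consists of the elements with a fixed point. -/
theorem exists_busemannHom {h : H} {x : P} {τ κ : ℤ} (hh : IsAxial d h x τ κ)
    (hfix : ∀ k : H, ∃ B, ∀ n : ℕ, d (h ^ n • x) (k • h ^ n • x) ≤ B) :
    ∃ β : H →* Multiplicative ℤ, ∀ k, β k = 1 ↔ FixesPoint P k := by
  choose b n₀ hb using hd.exists_busemann hh
  choose B hB using hfix
  have hτ := hh.pos
  have hκ := hh.nonneg
  have hlarge : ∀ C : ℤ, ∃ n : ℕ, ∀ m ≥ n, C < d x (h ^ m • x) := by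
    intro C
    refine ⟨C.toNat + 1, fun m hm => ?_⟩
    rw [hh.pow m (by omega)]
    have : (m : ℤ) ≤ m * τ := le_mul_of_one_le_right (by positivity) hτ
    omega
  have key : ∀ (k : H) (y : P), b (k • y) = b y + b (k • x) := by
    intro k y
    obtain ⟨n₁, hn₁⟩ := hlarge (d (k • y) (k • x) + B k + d x (k • x) + d x y)
    set n := n₁ + n₀ y + n₀ (k • x) + n₀ (k • y) with hn
    have h1 := hb (k • y) n (by omega)
    have h2 := hb y n (by omega)
    have h3 := hb (k • x) n (by omega)
    have h4 := hn₁ n (by omega)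
    have h5 := hB k n
    have e1 : d (k • y) (k • h ^ n • x) = d y (h ^ n • x) := hd.inv _ _ _
    have e2 : d (k • x) (k • h ^ n • x) = d x (h ^ n • x) := hd.inv _ _ _
    have f1 := hd.four (k • y) (h ^ n • x) (k • x) (k • h ^ n • x)
    have f2 := hd.four (k • y) (k • h ^ n • x) (k • x) (h ^ n • x)
    have s1 := hd.symm (h ^ n • x) (k • h ^ n • x)
    have s2 := hd.symm (h ^ n • x) (k • x)
    have s3 := hd.symm (k • h ^ n • x) (k • x)
    have t1 := hd.triangle x (k • x) (h ^ n • x)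
    have t2 := hd.triangle x y (h ^ n • x)
    have t3 := hd.nonneg x (k • x)
    have t4 := hd.nonneg x y
    have t5 := hd.nonneg (k • y) (h ^ n • x)
    have t6 := hd.nonneg y (h ^ n • x)
    omega
  have hbx : b x = 0 := by
    have := hb x (n₀ x) le_rfl
    omega
  refine ⟨MonoidHom.mk' (fun k => Multiplicative.ofAdd (b (k • x))) fun k l => ?_, fun k => ?_⟩
  · rw [mul_smul, key k (l • x), ← ofAdd_add, add_comm]
  have hiff : (MonoidHom.mk' (fun k : H => Multiplicative.ofAdd (b (k • x))) (fun k l => by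
      rw [mul_smul, key k (l • x), ← ofAdd_add, add_comm])) k = 1 ↔ b (k • x) = 0 := by
    rw [MonoidHom.mk'_apply, ofAdd_eq_one]
  rw [hiff]
  constructor
  · intro hk
    obtain ⟨n₁, hn₁⟩ := hlarge (d x (k • x) + B k)
    set n := n₁ + n₀ (k • x) with hn
    have h1 := hb (k • x) n (by omega)
    have h2 := hn₁ n (by omega)
    have h3 := hB k n
    have h4 := hd.nonneg (h ^ n • x) (k • h ^ n • x)
    have h5 := hd.nonneg x (k • x)
    set y := h ^ n • x with hy
    -- The geodesics from `x` and from `k • x` to the end merge at equal distances.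
    obtain ⟨z, hz1, hz2⟩ := hd.geod x y (d x y - B k) (by omega) (by omega)
    have e1 : d (k • x) (k • y) = d x y := hd.inv _ _ _
    have f1 := hd.four z (k • x) x y
    have t1 := hd.triangle (k • x) z y
    have s1 := hd.symm z x
    have s2 := hd.symm (k • x) x
    have s3 := hd.symm z (k • x)
    refine ⟨z, hd.eq_of_gromov (p := k • x) (y := k • y) (y' := y) (m := d x y - B k)
      ?_ ?_ ?_ ?_ ?_⟩
    · rw [hd.inv, hz1]
    · rw [hd.inv, hz2, e1]
    · omega
    · omega
    · have := hd.symm y (k • y)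
      omega
  · rintro ⟨p, hp⟩
    have := key k p
    rw [hp] at this
    omega

/-! ### Groups acting on trees -/

/-- The space of ends: sequences of points modulo bounded distance. -/
theorem exists_ends : ∃ (E : Type v) (_ : MulAction H E) (π : (ℕ → P) → E),
    (∀ (k : H) u, π (fun n => k • u n) = k • π u) ∧
      ∀ u w, π u = π w ↔ ∃ B, ∀ n, d (u n) (w n) ≤ B := by
  let S : Setoid (ℕ → P) :=
    { r := fun u w => ∃ B, ∀ n, d (u n) (w n) ≤ B
      iseqv :=
        { refl := fun u => ⟨0, fun n => (hd.self _).le⟩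
          symm := fun ⟨B, hB⟩ => ⟨B, fun n => by rw [hd.symm]; exact hB n⟩
          trans := fun {u v w} ⟨B, hB⟩ ⟨C, hC⟩ => ⟨B + C, fun n =>
            (hd.triangle _ (v n) _).trans (add_le_add (hB n) (hC n))⟩ } }
  let A : MulAction H (Quotient S) :=
    { smul := fun k => Quotient.map (fun u n => k • u n) fun u w ⟨B, hB⟩ =>
        ⟨B, fun n => by rw [hd.inv]; exact hB n⟩
      one_smul := by
        rintro ⟨u⟩
        exact congrArg (Quotient.mk S) (funext fun n => one_smul H (u n))
      mul_smul := by
        rintro k l ⟨u⟩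
        exact congrArg (Quotient.mk S) (funext fun n => mul_smul k l (u n)) }
  exact ⟨Quotient S, A, fun u => Quotient.mk S u, fun k u => rfl, fun u w =>
    ⟨fun h => Quotient.exact h, fun h => Quotient.sound (s := S) h⟩⟩

/-- A group acting on a tree without inversions either consists of elements with fixed points, or
contains a free group of rank two acting freely, or fixes an end or preserves a line. In the last
case the elements fixing a point and an end form a normal subgroup, and if that is trivial then the
group is infinite cyclic or infinite dihedral. -/
theorem trichotomy [Nonempty P] : (∀ g : H, FixesPoint P g) ∨
    (∃ f : FreeGroup (Fin 2) →* H, ∀ w, w ≠ 1 → ¬ FixesPoint P (f w)) ∨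
    ∃ N : Subgroup H, N.Normal ∧ (∀ g ∈ N, FixesPoint P g) ∧
      (N = ⊥ → Nonempty (H ≃* Multiplicative ℤ) ∨ Nonempty (H ≃* DihedralGroup 0)) := by
  rw [or_iff_not_imp_left, or_iff_not_imp_left]
  intro hne hfree
  push Not at hne
  obtain ⟨h, hh⟩ := hne
  obtain ⟨x⟩ := ‹Nonempty P›
  obtain ⟨τ, κ, hax⟩ := hd.exists_isAxial hh x
  have hax' := hd.isAxial_inv hax
  obtain ⟨E, _, π, hπ, hπeq⟩ := hd.exists_ends
  set ε : Bool → E := fun s => π fun n => (cond s h h⁻¹) ^ n • x with hε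
  have hε' : ∀ (k : H) s, k • ε s = π fun n => k • (cond s h h⁻¹) ^ n • x := fun k s =>
    (hπ k _).symm
  have hπdist : ∀ u, (∃ B, ∀ n, d (u n) (h • u n) ≤ B) → h • π u = π u := by
    intro u hu
    rw [← hπ, eq_comm, hπeq]
    exact hu
  have hfixε : ∀ s, h • ε s = ε s := by
    intro s
    refine hπdist _ ⟨d x (h • x), fun n => ?_⟩
    have hc : Commute h (cond s h h⁻¹) := by
      cases s
      exacts [(Commute.refl h).inv_right, Commute.refl h]
    rw [← mul_smul, (hc.pow_right n).eq, mul_smul, hd.inv]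
  have hab : ε true ≠ ε false := by
    intro heq
    obtain ⟨B, hB⟩ := (hπeq _ _).1 heq
    have h1 := hB (B.toNat + 1)
    simp only [cond_true, cond_false] at h1
    rw [hd.symm, inv_pow, hd.dist_inv_smul, ← mul_smul, ← pow_add, hax.pow _ (by omega)] at h1
    have := hax.nonneg
    have h2 := hax.pos
    have : ((B.toNat + 1 + (B.toNat + 1) : ℕ) : ℤ) ≤ (B.toNat + 1 + (B.toNat + 1) : ℕ) * τ :=
      le_mul_of_one_le_right (by positivity) h2
    omega
  have H1 : ∀ m : H, m • ε true = ε true ∨ m • ε true = ε false ∨ m • ε false = ε true ∨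
      m • ε false = ε false := by
    intro m
    obtain ⟨s, t, hst⟩ := (hd.pingpong_or_bounded (k := m) hax).resolve_left hfree
    have := (hπeq _ _).2 hst
    rw [← hε'] at this
    cases s <;> cases t
    · exact Or.inr (Or.inr (Or.inr this.symm))
    · exact Or.inr (Or.inl this.symm)
    · exact Or.inr (Or.inr (Or.inl this.symm))
    · exact Or.inl this.symm
  have H2 : ∀ (m : H) (y : E), y = ε true ∨ y = ε false → h • m • y = m • y →
      m • y = ε true ∨ m • y = ε false := by
    intro m y hy hfix
    obtain ⟨s, rfl⟩ : ∃ s, y = ε s := by rcases hy with rfl | rfl <;> exact ⟨_, rfl⟩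
    rw [hε', ← hπ, hπeq] at hfix
    have haxs : IsAxial d (cond s h h⁻¹) x τ κ := by cases s; exacts [hax', hax]
    obtain ⟨t, ht⟩ := hd.bounded_of_fixes_end hax haxs hfix
    have := (hπeq _ _).2 ht
    rw [← hε'] at this
    cases t
    · exact Or.inr this.symm
    · exact Or.inl this.symm
  have injective_of : ∀ {K : Subgroup H} {β : K →* Multiplicative ℤ},
      (∀ k, β k = 1 ↔ FixesPoint P k) → (∀ k : K, FixesPoint P k → k = 1) → h ∈ K →
      Nonempty (K ≃* Multiplicative ℤ) := by
    intro K β hβ hK hhK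
    refine nonempty_mulEquiv_int (β := β) (h := ⟨h, hhK⟩) ?_ ?_
    · rw [injective_iff_map_eq_one]
      exact fun k hk => hK k ((hβ k).1 hk)
    · rw [Ne, hβ]
      exact hh
  -- A group fixing an end of the axis of `h`.
  have busemann : ∀ (K : Subgroup H) (s : Bool), h ∈ K → (∀ k ∈ K, k • ε s = ε s) →
      ∃ β : K →* Multiplicative ℤ, ∀ k, β k = 1 ↔ FixesPoint P k := by
    intro K s hhK hK
    have haxs : IsAxial d (cond s h h⁻¹) x τ κ := by cases s; exacts [hax', hax]
    have hmem : cond s h h⁻¹ ∈ K := by cases s; exacts [inv_mem hhK, hhK]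
    refine (hd.subgroup K).exists_busemannHom (h := ⟨_, hmem⟩) (x := x) (τ := τ) (κ := κ)
      ⟨haxs.pos, haxs.nonneg, haxs.pow⟩ fun k => ?_
    exact (hπeq _ _).1 ((hK k k.2).symm.trans (hε' k s))
  have fixed : ∀ s, (∀ m : H, m • ε s = ε s) → ∃ N : Subgroup H, N.Normal ∧
      (∀ g ∈ N, FixesPoint P g) ∧
      (N = ⊥ → Nonempty (H ≃* Multiplicative ℤ) ∨ Nonempty (H ≃* DihedralGroup 0)) := by
    intro s hs
    obtain ⟨β, hβ⟩ := busemann ⊤ s trivial fun k _ => hs k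
    set γ : H →* Multiplicative ℤ := β.comp Subgroup.topEquiv.symm.toMonoidHom with hγ
    have hγiff : ∀ g : H, γ g = 1 ↔ FixesPoint P g := fun g => hβ ⟨g, trivial⟩
    refine ⟨γ.ker, inferInstance, fun g hg => (hγiff g).1 hg, fun hbot => Or.inl ?_⟩
    obtain ⟨e⟩ := injective_of hβ (fun k hk => Subtype.ext (by
      have : (k : H) ∈ γ.ker := (hγiff k).2 hk
      rwa [hbot, Subgroup.mem_bot] at this)) (Subgroup.mem_top h)
    exact ⟨Subgroup.topEquiv.symm.trans e⟩
  rcases fixes_end_or_preserves_pair hab (hfixε true) (hfixε false) H1 H2 with hT | hF | hpair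
  · exact fixed true hT
  · exact fixed false hF
  -- The pair of ends is preserved; `K` is the subgroup fixing both.
  set K : Subgroup H := MulAction.stabilizer H (ε true) with hK
  have hKmem : ∀ k, k ∈ K ↔ k • ε true = ε true := fun k => MulAction.mem_stabilizer_iff
  have hKF : ∀ k ∈ K, k • ε false = ε false := by
    intro k hk
    rcases hpair k with h1 | h1
    · exact h1.2
    · exact absurd (((hKmem k).1 hk).symm.trans h1.1) hab
  have hhK : h ∈ K := (hKmem h).2 (hfixε true)
  obtain ⟨β, hβ⟩ := busemann K true hhK fun k hk => (hKmem k).1 hk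
  have hconj : ∀ g, ∀ k ∈ K, g * k * g⁻¹ ∈ K := by
    intro g k hk
    rw [hKmem, mul_smul, mul_smul, smul_eq_iff_eq_inv_smul]
    rcases hpair g⁻¹ with h1 | h1
    · rw [h1.1, (hKmem k).1 hk]
    · rw [h1.1, hKF k hk]
  have hNmem : ∀ g, g ∈ β.ker.map K.subtype ↔ g ∈ K ∧ FixesPoint P g := by
    intro g
    constructor
    · rintro ⟨k, hk, rfl⟩
      exact ⟨k.2, (hβ k).1 hk⟩
    · rintro ⟨hg, hfix⟩
      exact ⟨⟨g, hg⟩, (hβ ⟨g, hg⟩).2 hfix, rfl⟩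
  refine ⟨β.ker.map K.subtype, ⟨fun n hn g => ?_⟩, fun g hg => ((hNmem g).1 hg).2, fun hbot => ?_⟩
  · obtain ⟨hnK, p, hp⟩ := (hNmem n).1 hn
    exact (hNmem _).2 ⟨hconj g n hnK, g • p, by rw [mul_smul, inv_smul_smul, mul_smul, hp]⟩
  obtain ⟨φ⟩ := injective_of hβ (fun k hk => Subtype.ext (by
    have : (k : H) ∈ β.ker.map K.subtype := (hNmem k).2 ⟨k.2, hk⟩
    rwa [hbot, Subgroup.mem_bot] at this)) hhK
  by_cases htop : ∃ t, t ∉ K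
  · right
    obtain ⟨t, ht⟩ := htop
    have swap : ∀ g, g ∉ K → g • ε true = ε false ∧ g • ε false = ε true := by
      intro g hg
      exact (hpair g).resolve_left fun h1 => hg ((hKmem g).2 h1.1)
    refine nonempty_mulEquiv_dihedralGroup_of_index_two φ ht (fun g hg => ?_) (hconj t) hhK ?_
    · rw [hKmem, mul_smul, (swap g hg).1, inv_smul_eq_iff, (swap t ht).1]
    · -- If `t` commuted with `h` it would fix the ends of the axis of `h`.
      intro hcomm
      rw [mul_inv_eq_iff_eq_mul] at hcomm
      refine ht ((hKmem t).2 ?_)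
      rw [hε', hπeq]
      refine ⟨d (t • x) x, fun n => ?_⟩
      have hc : Commute t h := hcomm
      rw [cond_true, ← mul_smul, (hc.pow_right n).eq, mul_smul, hd.inv]
  · left
    push Not at htop
    have hKtop : K = ⊤ := by
      rw [eq_top_iff]
      exact fun g _ => htop g
    exact ⟨(Subgroup.topEquiv.symm.trans (MulEquiv.subgroupCongr hKtop.symm)).trans φ⟩

end IsTreeAction

/-! ### The distance of a tree is a tree metric -/

section Tree

variable {W : Type*} {T : SimpleGraph W}

/-- In a tree, an edge leading away from `z` and towards `y` lies on the geodesic from `z` to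
`y`. -/
theorem dist_eq_add_of_adj (hT : T.IsTree) {x x' y z : W} (h : T.Adj x x')
    (hz : T.dist z x' = T.dist z x + 1) (hy : T.dist y x = T.dist y x' + 1) :
    T.dist z y = T.dist z x + 1 + T.dist x' y := by
  classical
  obtain ⟨p, hp, hpl⟩ := hT.connected.exists_path_of_dist z x
  obtain ⟨q, hq, hql⟩ := hT.connected.exists_path_of_dist x' y
  obtain ⟨r, hr, hrl⟩ := hT.connected.exists_path_of_dist z y
  have hmid : ∀ {a b u : W} (w : T.Walk a b), u ∈ w.support →
      T.dist a u + T.dist u b ≤ w.length := by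
    intro a b u w hu
    have h1 := congrArg SimpleGraph.Walk.length (w.take_spec hu)
    rw [SimpleGraph.Walk.length_append] at h1
    have h2 := SimpleGraph.dist_le (w.takeUntil u hu)
    have h3 := SimpleGraph.dist_le (w.dropUntil u hu)
    omega
  have hpath : (p.append (SimpleGraph.Walk.cons h q)).IsPath := by
    rw [SimpleGraph.Walk.isPath_def, SimpleGraph.Walk.support_append,
      SimpleGraph.Walk.support_cons, List.tail_cons, List.nodup_append]
    refine ⟨hp.support_nodup, hq.support_nodup, fun u hu u' hu' huu' => ?_⟩
    subst huu'
    -- A common vertex of the two geodesics would be closer to both `x` and `x'`.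
    have h1 := hmid p hu
    have h2 := hmid q hu'
    have h3 := hT.connected.dist_triangle (u := z) (v := u) (w := x')
    have h4 := hT.connected.dist_triangle (u := y) (v := u) (w := x)
    rw [T.dist_comm (u := x') (v := u)] at h2
    rw [T.dist_comm (u := y) (v := u)] at h4
    rw [T.dist_comm (u := y) (v := x')] at hy
    omega
  have huniq := (hT.existsUnique_path z y).unique hr hpath
  rw [← hrl, huniq, SimpleGraph.Walk.length_append, SimpleGraph.Walk.length_cons, hpl, hql]
  omega

theorem isTreeMetric_dist (hT : T.IsTree) : IsTreeMetric fun x y => (T.dist x y : ℤ) where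
  self x := by simp
  symm x y := by rw [T.dist_comm]
  eq_of x y h := hT.connected.dist_eq_zero_iff.1 (by exact_mod_cast h)
  four x y z w := by
    induction hn : T.dist x y generalizing x with
    | zero =>
      obtain rfl := hT.connected.dist_eq_zero_iff.1 hn
      have := hT.connected.dist_triangle (u := z) (v := x) (w := w)
      rw [T.dist_comm (u := z) (v := x)] at this
      push_cast
      omega
    | succ n ih =>
      obtain ⟨p, hp⟩ := hT.connected.exists_walk_length_eq_dist x y
      cases p with
      | nil => simp at hn
      | @cons _ x' _ h p =>
        rw [SimpleGraph.Walk.length_cons] at hp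
        have h1 := SimpleGraph.dist_le p
        have hx'y : T.dist x' y = n := by
          have := hT.dist_eq_dist_add_one_of_adj y h
          rw [T.dist_comm (u := y), T.dist_comm (u := y)] at this
          omega
        have hy : T.dist y x = T.dist y x' + 1 := by
          rw [T.dist_comm (u := y), T.dist_comm (u := y), hn, hx'y]
        have key : ∀ v, T.dist v x' = T.dist v x + 1 → T.dist v y = T.dist v x + 1 + n :=
          fun v hv => hx'y ▸ dist_eq_add_of_adj hT h hv hy
        have hi := ih x' hx'y
        have hz := hT.dist_eq_dist_add_one_of_adj z h
        have hw := hT.dist_eq_dist_add_one_of_adj w h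
        have c1 := T.dist_comm (u := x) (v := z)
        have c2 := T.dist_comm (u := x) (v := w)
        have c3 := T.dist_comm (u := y) (v := z)
        have c4 := T.dist_comm (u := y) (v := w)
        have c5 := T.dist_comm (u := x') (v := z)
        have c6 := T.dist_comm (u := x') (v := w)
        have t := hT.connected.dist_triangle (u := z) (v := x) (w := w)
        push_cast
        rcases hz with hz | hz <;> rcases hw with hw | hw
        · omega
        · have := key w hw
          omega
        · have := key z hz
          omega
        · have := key z hz
          have := key w hw
          omega
  geod x y n h0 hn := by
    obtain ⟨p, hp⟩ := hT.connected.exists_walk_length_eq_dist x y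
    lift n to ℕ using h0
    have h1 := SimpleGraph.dist_le (p.take n)
    have h2 := SimpleGraph.dist_le (p.drop n)
    rw [SimpleGraph.Walk.take_length] at h1
    rw [SimpleGraph.Walk.drop_length] at h2
    have h3 := hT.connected.dist_triangle (u := x) (v := p.getVert n) (w := y)
    exact ⟨p.getVert n, by omega, by omega⟩

end Tree

/-! ### The Bass–Serre tree of a vertex -/

section BassSerre

variable {V : Type u} (Γ : SimpleGraph V) (G : V → Type w) [∀ v, Group (G v)]

/-- The vertices of the Bass–Serre tree of the splitting of the graph product as an amalgam of
`G_{V ∖ v}` and `G_{star v}` over `G_{link v}`. -/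
abbrev TreeVertex (v : V) : Type (max u w) :=
  (GraphProduct Γ G ⧸ fullSubgroup Γ G {v}ᶜ) ⊕ (GraphProduct Γ G ⧸ fullSubgroup Γ G (star Γ v))

/-- The coset `g G_{V ∖ v}` as a vertex of the tree. -/
def leftVertex (v : V) (g : GraphProduct Γ G) : TreeVertex Γ G v := Sum.inl (QuotientGroup.mk g)

/-- The coset `g G_{star v}` as a vertex of the tree. -/
def rightVertex (v : V) (g : GraphProduct Γ G) : TreeVertex Γ G v := Sum.inr (QuotientGroup.mk g)

/-- The Bass–Serre tree of `v`: two cosets of different kinds are adjacent if they have a common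
element. -/
def bassSerreTree (v : V) : SimpleGraph (TreeVertex Γ G v) where
  Adj p q := ∃ g, p = leftVertex Γ G v g ∧ q = rightVertex Γ G v g ∨
    p = rightVertex Γ G v g ∧ q = leftVertex Γ G v g
  symm := ⟨fun p q ⟨g, h⟩ => ⟨g, h.symm.imp And.symm And.symm⟩⟩
  loopless := ⟨fun p ⟨g, h⟩ => by
    rcases h with ⟨h1, h2⟩ | ⟨h1, h2⟩
    · exact Sum.inl_ne_inr (h1.symm.trans h2)
    · exact Sum.inl_ne_inr (h2.symm.trans h1)⟩

variable {Γ G}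

theorem leftVertex_eq_iff {v : V} {g h : GraphProduct Γ G} :
    leftVertex Γ G v g = leftVertex Γ G v h ↔ g⁻¹ * h ∈ fullSubgroup Γ G {v}ᶜ := by
  rw [leftVertex, leftVertex, Sum.inl.injEq, QuotientGroup.eq]

theorem rightVertex_eq_iff {v : V} {g h : GraphProduct Γ G} :
    rightVertex Γ G v g = rightVertex Γ G v h ↔ g⁻¹ * h ∈ fullSubgroup Γ G (star Γ v) := by
  rw [rightVertex, rightVertex, Sum.inr.injEq, QuotientGroup.eq]

theorem exists_vertex_eq {v : V} (p : TreeVertex Γ G v) :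
    (∃ g, p = leftVertex Γ G v g) ∨ ∃ g, p = rightVertex Γ G v g := by
  rcases p with ⟨⟨g⟩⟩ | ⟨⟨g⟩⟩
  exacts [Or.inl ⟨g, rfl⟩, Or.inr ⟨g, rfl⟩]

theorem adj_left_right (v : V) (g : GraphProduct Γ G) :
    (bassSerreTree Γ G v).Adj (leftVertex Γ G v g) (rightVertex Γ G v g) :=
  ⟨g, Or.inl ⟨rfl, rfl⟩⟩

theorem bassSerreTree_connected (v : V) : (bassSerreTree Γ G v).Connected := by
  have hleft : ∀ g, (bassSerreTree Γ G v).Reachable (leftVertex Γ G v 1) (leftVertex Γ G v g) := by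
    intro g
    induction g using induction_right with
    | one => rfl
    | mul g t c ih =>
      refine ih.trans ?_
      by_cases htv : t = v
      · subst htv
        have h : rightVertex Γ G t g = rightVertex Γ G t (g * of Γ G t c) := by
          rw [rightVertex_eq_iff, inv_mul_cancel_left]
          exact mem_star_of c
        have h2 := (adj_left_right t (g * of Γ G t c)).symm.reachable
        rw [← h] at h2
        exact (adj_left_right t g).reachable.trans h2
      · have h : leftVertex Γ G v g = leftVertex Γ G v (g * of Γ G t c) := by
          rw [leftVertex_eq_iff, inv_mul_cancel_left]
          exact of_mem_fullSubgroup htv c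
        rw [h]
  have hbase : ∀ p, (bassSerreTree Γ G v).Reachable (leftVertex Γ G v 1) p := by
    intro p
    rcases exists_vertex_eq p with ⟨g, rfl⟩ | ⟨g, rfl⟩
    · exact hleft g
    · exact (hleft g).trans (adj_left_right v g).reachable
  exact {
    preconnected := fun p q => (hbase p).symm.trans (hbase q)
    nonempty := ⟨leftVertex Γ G v 1⟩ }

/-- The wall function is constant on every coset of `G_{star v}` other than `G_{star v}` itself. -/
theorem wall_eq_of_star {v : V} {g s : GraphProduct Γ G} (hg : g ∉ fullSubgroup Γ G (star Γ v))
    (hs : s ∈ fullSubgroup Γ G (star Γ v)) : wall v (g * s) = wall v g := by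
  induction hs using fullSubgroup_induction_right with
  | one => rw [mul_one]
  | mul s hs t ht c ih =>
    rw [← mul_assoc,
      wall_mul_of_notMem t c fun h => hg ((Subgroup.mul_mem_cancel_right _ hs).1 h), ih]

/-- The side of the edge of the tree at `g` on which a vertex lies: `True` on the side of the coset
`g G_{V ∖ v}`. It is read off from the wall function. -/
def edgeSide (v : V) (g : GraphProduct Γ G) : TreeVertex Γ G v → Prop :=
  Sum.elim
    (Quotient.lift (fun h => wall v (g⁻¹ * h) = 1) fun a b hab => by
      have h1 : a⁻¹ * b ∈ fullSubgroup Γ G {v}ᶜ := QuotientGroup.leftRel_apply.1 hab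
      have h2 := wall_mul_right (v := v) (S := {v}ᶜ) (by simp) (g⁻¹ * a) h1
      rw [mul_assoc, mul_inv_cancel_left] at h2
      rw [h2])
    (Quotient.lift (fun h => g⁻¹ * h ∉ fullSubgroup Γ G (star Γ v) ∧ wall v (g⁻¹ * h) = 1)
      fun a b hab => by
        have h1 : a⁻¹ * b ∈ fullSubgroup Γ G (star Γ v) := QuotientGroup.leftRel_apply.1 hab
        have h2 : g⁻¹ * b = g⁻¹ * a * (a⁻¹ * b) := by group
        rw [h2, Subgroup.mul_mem_cancel_right _ h1]
        exact propext (and_congr_right fun h3 => by rw [wall_eq_of_star h3 h1]))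

theorem edgeSide_left {v : V} (g h : GraphProduct Γ G) :
    edgeSide v g (leftVertex Γ G v h) ↔ wall v (g⁻¹ * h) = 1 := Iff.rfl

theorem edgeSide_right {v : V} (g h : GraphProduct Γ G) :
    edgeSide v g (rightVertex Γ G v h) ↔
      g⁻¹ * h ∉ fullSubgroup Γ G (star Γ v) ∧ wall v (g⁻¹ * h) = 1 := Iff.rfl

/-- The only edge joining the two sides of the edge at `g` is that edge itself. -/
theorem edgeSide_iff {v : V} {g h : GraphProduct Γ G}
    (hne : s(leftVertex Γ G v h, rightVertex Γ G v h) ≠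
      s(leftVertex Γ G v g, rightVertex Γ G v g)) :
    edgeSide v g (leftVertex Γ G v h) ↔ edgeSide v g (rightVertex Γ G v h) := by
  rw [edgeSide_left, edgeSide_right]
  refine ⟨fun hw => ⟨fun hs => hne ?_, hw⟩, And.right⟩
  have hl := mem_link_of_mem_star hs hw
  have e1 : leftVertex Γ G v g = leftVertex Γ G v h := leftVertex_eq_iff.2
    (fullSubgroup_mono (fun t ht => by
      rintro rfl
      exact Γ.loopless.irrefl _ ht) hl)
  have e2 : rightVertex Γ G v g = rightVertex Γ G v h := rightVertex_eq_iff.2 hs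
  rw [e1, e2]

theorem bassSerreTree_isTree (v : V) : (bassSerreTree Γ G v).IsTree := by
  refine ⟨bassSerreTree_connected v, ?_⟩
  have hbridge : ∀ g, (bassSerreTree Γ G v).IsBridge
      s(leftVertex Γ G v g, rightVertex Γ G v g) := by
    intro g
    rw [SimpleGraph.isBridge_iff]
    rintro ⟨p⟩
    have hinv : ∀ {a b} (_ : ((bassSerreTree Γ G v).deleteEdges
        {s(leftVertex Γ G v g, rightVertex Γ G v g)}).Walk a b),
        edgeSide v g a ↔ edgeSide v g b := by
      intro a b p
      induction p with
      | nil => rfl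
      | cons hadj p ih =>
        refine Iff.trans ?_ ih
        rw [SimpleGraph.deleteEdges_adj] at hadj
        obtain ⟨⟨h, ⟨rfl, rfl⟩ | ⟨rfl, rfl⟩⟩, hne⟩ := hadj
        · exact edgeSide_iff hne
        · exact (edgeSide_iff fun h => hne (Sym2.eq_swap.trans h)).symm
    have h1 := hinv p
    rw [edgeSide_left, edgeSide_right, inv_mul_cancel, wall_one] at h1
    exact (h1.1 rfl).1 (one_mem _)
  rw [SimpleGraph.isAcyclic_iff_forall_adj_isBridge]
  rintro p q ⟨g, ⟨rfl, rfl⟩ | ⟨rfl, rfl⟩⟩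
  · exact hbridge g
  · rw [Sym2.eq_swap]
    exact hbridge g

theorem smul_leftVertex (v : V) (k g : GraphProduct Γ G) :
    k • leftVertex Γ G v g = leftVertex Γ G v (k * g) := rfl

theorem smul_rightVertex (v : V) (k g : GraphProduct Γ G) :
    k • rightVertex Γ G v g = rightVertex Γ G v (k * g) := rfl

/-- The graph product acts on the Bass–Serre tree without inversions. -/
theorem isTreeAction_bassSerreTree (v : V) :
    IsTreeAction (GraphProduct Γ G)
      fun x y : TreeVertex Γ G v => ((bassSerreTree Γ G v).dist x y : ℤ) where
  toIsTreeMetric := isTreeMetric_dist (bassSerreTree_isTree v)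
  inv := by
    have hle : ∀ (g : GraphProduct Γ G) (x y : TreeVertex Γ G v),
        (bassSerreTree Γ G v).dist (g • x) (g • y) ≤ (bassSerreTree Γ G v).dist x y := by
      intro g x y
      let f : bassSerreTree Γ G v →g bassSerreTree Γ G v :=
        ⟨fun p => g • p, by
          rintro _ _ ⟨h, ⟨rfl, rfl⟩ | ⟨rfl, rfl⟩⟩
          · exact ⟨g * h, Or.inl ⟨rfl, rfl⟩⟩
          · exact ⟨g * h, Or.inr ⟨rfl, rfl⟩⟩⟩
      obtain ⟨p, hp⟩ := (bassSerreTree_connected v).exists_walk_length_eq_dist x y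
      rw [← hp, ← SimpleGraph.Walk.length_map f]
      exact SimpleGraph.dist_le (p.map f)
    intro g x y
    have h1 := hle g x y
    have h2 := hle g⁻¹ (g • x) (g • y)
    rw [inv_smul_smul, inv_smul_smul] at h2
    exact_mod_cast le_antisymm h1 h2
  even := by
    intro g x
    let c : (bassSerreTree Γ G v).Coloring Bool := SimpleGraph.Coloring.mk Sum.isLeft (by
      rintro _ _ ⟨h, ⟨rfl, rfl⟩ | ⟨rfl, rfl⟩⟩
      · exact Bool.noConfusion
      · exact Bool.noConfusion)
    obtain ⟨p, hp⟩ := (bassSerreTree_connected v).exists_walk_length_eq_dist x (g • x)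
    have h : Even p.length := by
      rw [c.even_length_iff_congr p]
      rcases x with x | x <;> exact Iff.rfl
    rw [← hp]
    exact_mod_cast h

/-- The stabilisers of the vertices of the tree are parabolic. -/
theorem exists_conjFullSubgroup_of_fixed [Nontrivial V] (hΓ : IsIrreducible Γ) {v : V}
    (p : TreeVertex Γ G v) : ∃ (f : GraphProduct Γ G) (S : Set V), S ≠ Set.univ ∧
      ∀ g : GraphProduct Γ G, g • p = p → g ∈ conjFullSubgroup Γ G f S := by
  rcases exists_vertex_eq p with ⟨f, rfl⟩ | ⟨f, rfl⟩
  · refine ⟨f, {v}ᶜ, fun h => ?_, fun g hg => ?_⟩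
    · have : v ∈ ({v}ᶜ : Set V) := h ▸ Set.mem_univ v
      exact this rfl
    · rw [smul_leftVertex, eq_comm, leftVertex_eq_iff, ← mul_assoc] at hg
      exact mem_conjFullSubgroup.2 hg
  · refine ⟨f, star Γ v, star_ne_univ hΓ v, fun g hg => ?_⟩
    rw [smul_rightVertex, eq_comm, rightVertex_eq_iff, ← mul_assoc] at hg
    exact mem_conjFullSubgroup.2 hg

/-- A parabolic subgroup whose type omits `v` fixes a point of the tree of `v`. -/
theorem fixesPoint_of_mem_conj {v : V} {S : Set V} (hv : v ∉ S) {f g : GraphProduct Γ G}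
    (hg : g ∈ conjFullSubgroup Γ G f S) : FixesPoint (TreeVertex Γ G v) g := by
  refine ⟨leftVertex Γ G v f, ?_⟩
  rw [smul_leftVertex, eq_comm, leftVertex_eq_iff, ← mul_assoc]
  refine fullSubgroup_mono (fun t ht => ?_) (mem_conjFullSubgroup.1 hg)
  rintro rfl
  exact hv ht

/-- A subgroup all of whose elements fix points of the tree lies in a proper parabolic subgroup.
Among its subgroups with a common fixed point, choose one with the largest parabolic closure; by
Serre's lemma it can be enlarged by any element, which must lie in the same closure. -/
theorem exists_proper_parabolic_of_fixesPoint [Finite V] [Nontrivial V] (hΓ : IsIrreducible Γ)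
    (v : V) (H : Subgroup (GraphProduct Γ G))
    (hH : ∀ g ∈ H, FixesPoint (TreeVertex Γ G v) g) :
    ∃ (f : GraphProduct Γ G) (S : Set V), S ≠ Set.univ ∧ H ≤ conjFullSubgroup Γ G f S := by
  classical
  have hd := isTreeAction_bassSerreTree (Γ := Γ) (G := G) v
  choose cf cS hcle hcmin using exists_parabolicClosure (Γ := Γ) (G := G)
  let good : ℕ → Prop := fun n => ∃ K ≤ H, (∃ p : TreeVertex Γ G v, ∀ g ∈ K, g • p = p) ∧
    (cS K).ncard = n
  have hbound : ∀ n, good n → n ≤ Nat.card V := by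
    rintro _ ⟨K, -, -, rfl⟩
    exact Set.ncard_le_card _
  have hbot : good (cS ⊥).ncard := ⟨⊥, bot_le, ⟨leftVertex Γ G v 1, fun g hg => by
    rw [Subgroup.mem_bot.1 hg, one_smul]⟩, rfl⟩
  obtain ⟨K, hKH, ⟨p, hp⟩, hKn⟩ := Nat.findGreatest_spec (hbound _ hbot) hbot
  have hmax : ∀ n, good n → n ≤ (cS K).ncard := fun n hn =>
    hKn ▸ Nat.le_findGreatest (hbound n hn) hn
  obtain ⟨f₀, S₀, hS₀, hstab⟩ := exists_conjFullSubgroup_of_fixed hΓ p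
  have hKS := hcmin K f₀ S₀ fun g hg => hstab g (hp g hg)
  refine ⟨cf K, cS K, fun h => ?_, fun h hh => ?_⟩
  · have h1 := hKS
    rw [h, Set.ncard_univ] at h1
    exact hS₀ (Set.eq_of_subset_of_ncard_le (Set.subset_univ _) (by rwa [Set.ncard_univ]))
  · obtain ⟨q, hqK, hqh⟩ := hd.exists_common_fixed (A := K) (b := h) ⟨p, hp⟩ (hH h hh)
      fun a ha => hH _ (mul_mem (hKH ha) hh)
    set L := K ⊔ Subgroup.zpowers h
    have hLle : L ≤ MulAction.stabilizer (GraphProduct Γ G) q := by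
      refine sup_le (fun g hg => hqK g hg) ?_
      rw [Subgroup.zpowers_le]
      exact hqh
    have hLH : L ≤ H := sup_le hKH ((Subgroup.zpowers_le).2 hh)
    have hcard := hmax _ ⟨L, hLH, ⟨q, fun g hg => hLle hg⟩, rfl⟩
    -- The two closures have types of equal size, so that of `L` is also minimal for `K`.
    exact conjFullSubgroup_le_of_minimal (le_sup_left.trans (hcle L))
      (fun g T hT => hcard.trans (hcmin K g T hT)) (hcle K)
      (hcle L (le_sup_right (a := K) (Subgroup.mem_zpowers h)))

end BassSerre

end GraphProd

/-! ### Subgroups of graph products -/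

theorem theorem4p1 {V : Type*} [Finite V] [Nontrivial V] (Γ : SimpleGraph V)
    (hΓ : GraphProd.IsIrreducible Γ) (G : V → Type*) [∀ v, Group (G v)]
    (H : Subgroup (GraphProd.GraphProduct Γ G)) :
    (∃ K : Subgroup (GraphProd.GraphProduct Γ G), GraphProd.IsProperParabolic Γ G K ∧ H ≤ K) ∨
    Nonempty (H ≃* Multiplicative ℤ) ∨
    Nonempty (H ≃* DihedralGroup 0) ∨
    (∀ S : Set V, S ≠ Set.univ →
      ∃ F : Subgroup (GraphProd.GraphProduct Γ G), F ≤ H ∧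
        Nonempty (F ≃* FreeGroup (Fin 2)) ∧
        ∀ g : GraphProd.GraphProduct Γ G,
          F ⊓ GraphProd.conjFullSubgroup Γ G g S = ⊥) := by
  by_contra! hcon
  obtain ⟨hpar, hZ, hD, S, hS, hF⟩ := hcon
  have hpar' : ∀ (f : GraphProd.GraphProduct Γ G) (T : Set V), T ≠ Set.univ →
      ¬H ≤ GraphProd.conjFullSubgroup Γ G f T := fun f T hT => hpar _ ⟨T, f, hT, rfl⟩
  obtain ⟨v, hv⟩ := (Set.ne_univ_iff_exists_notMem S).1 hS
  have : Nonempty (GraphProd.TreeVertex Γ G v) := ⟨GraphProd.leftVertex Γ G v 1⟩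
  rcases ((GraphProd.isTreeAction_bassSerreTree (Γ := Γ) (G := G) v).subgroup H).trichotomy with
    hell | ⟨φ, hφ⟩ | ⟨N, hN, hell, hbot⟩
  · obtain ⟨f, T, hT, hle⟩ := GraphProd.exists_proper_parabolic_of_fixesPoint hΓ v H
      fun g hg => hell ⟨g, hg⟩
    exact hpar' f T hT hle
  -- The image of `φ` acts freely on the tree, and is therefore free and meets no `g G_S g⁻¹`.
  · have hinj : Function.Injective (H.subtype.comp φ) := by
      refine (injective_iff_map_eq_one _).2 fun w hw => by_contra fun hne => hφ w hne ?_
      have h1 : φ w = 1 := Subtype.ext hw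
      exact ⟨GraphProd.leftVertex Γ G v 1, by rw [h1, one_smul]⟩
    obtain ⟨g, hg⟩ := hF (H.subtype.comp φ).range
      (by rintro _ ⟨w, rfl⟩; exact (φ w).2) ⟨(MonoidHom.ofInjective hinj).symm⟩
    refine hg ((Subgroup.eq_bot_iff_forall _).2 ?_)
    rintro _ ⟨⟨w, rfl⟩, hw⟩
    by_contra hne
    refine hφ w (fun h => hne (by rw [h, map_one])) ?_
    exact GraphProd.fixesPoint_of_mem_conj hv hw
  · have hne : N ≠ ⊥ := fun h => (hbot h).elim (fun ⟨e⟩ => hZ.elim e) fun ⟨e⟩ => hD.elim e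
    have hKell : ∀ g ∈ N.map H.subtype, GraphProd.FixesPoint (GraphProd.TreeVertex Γ G v) g := by
      rintro _ ⟨g, hg, rfl⟩
      exact hell g hg
    obtain ⟨f₀, T₀, hT₀, hle₀⟩ := GraphProd.exists_proper_parabolic_of_fixesPoint hΓ v _ hKell
    obtain ⟨f, T, hle, hmin⟩ := GraphProd.exists_parabolicClosure (N.map H.subtype)
    have hT : T ≠ Set.univ := by
      rintro rfl
      exact hT₀ (Set.eq_of_subset_of_ncard_le (Set.subset_univ _) (hmin f₀ T₀ hle₀))
    -- A closure of empty type would be trivial, and so would `N`.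
    have hTne : T.Nonempty := by
      rw [Set.nonempty_iff_ne_empty]
      rintro rfl
      refine hne ((Subgroup.eq_bot_iff_forall _).2 fun g hg => ?_)
      have h1 := hle (Subgroup.mem_map_of_mem H.subtype hg)
      simpa [GraphProd.conjFullSubgroup, GraphProd.fullSubgroup] using h1
    refine hpar' f (T ∪ GraphProd.link Γ T) (GraphProd.union_link_ne_univ hΓ hTne hT) fun h hh => ?_
    refine GraphProd.mem_conj_union_link_of_normalizes hle hmin ?_
    rintro _ ⟨x, hx, rfl⟩
    exact ⟨_, hN.conj_mem' x hx ⟨h, hh⟩, rfl⟩
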